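/- **Setting.** Let $G$ be a finite connected simple graph obtained from component graphs by repeated clique-sums along cliques with two or three vertices (identify a clique of one graph with a clique of the same size of another one, and possibly delete some edges between vertices of the shared clique). The cliques used are called *separating sets*. The *component tree* $S$ has the components as nodes, two of them being adjacent if they share a separating set. Each component $N$ is drawn as a multigraph: it contains a *virtual* edge (virtual triangle) on each of its separating pairs (triplets), and every edge of $G$ is drawn as a *real* edge in exactly one component that contains both its ends. Each component is either planar, with a given planar embedding, or has at most $c$ vertices, $c$ a constant; let $m$ be a bound on the number of real edges in each component of the second kind. Assume: 1. in any component, a vertex is part of at most one separating set; 2. each separating set is shared by at most two components; 3. every virtual triangle in a planar component is an inner face of the given embedding. **Working tree.** Choose a node $c(S)$ ("center") of $S$ as the root; delete it from $S$, apply the same procedure recursively to the resulting subtrees $S_1,\dots,S_k$, and attach the roots of their working trees to $c(S)$ as children. The centers may be chosen arbitrarily. For a subtree $T$ of the working tree (a node with all its descendants) let $r(T)$ be its root, $l(T)$ its number of leaves, and $h(r(T))=L+1-\mathrm{level}(r(T))$, where the root of the working tree has level $1$ and $L$ is the largest level. Let $T_1,\dots,T_k$ be the subtrees attached at $r(T)$.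 Fix an integer $K>\max(2^{m+2},7)$. **Weights.** A weight is a skew-symmetric function $w$ from the directed edges of $G$ to $\mathbb Z$ ($w(u,v)=-w(v,u)$); virtual edges have weight $0$. The circulation of a cycle is the sum of the weights of its directed edges; the circulation of an inner face is that of its boundary traversed clockwise. - A weight $w_0$ satisfies, for each $T$: if $r(T)$ is not one of the planar components, its real edges are numbered $e_1,e_2,\dots$ and $e_j$ has weight $2^jK^{h(r(T))-1}l(T)$ in one, arbitrarily fixed, direction; if $r(T)$ is planar, every inner face of $r(T)$ that is not a virtual triangle has circulation $\sum_i 2K^{h(r(T_i))}l(T_i)$, the sum being over those $i$ for which the face is adjacent to the virtual edge or virtual triangle at which $T_i$ is attached to $r(T)$. - A weight $w_1$ is such that in planar components every inner face that is not a virtual triangle has circulation $1$, and all real edges of the other components have weight $0$. - A combination $w=\alpha w_0+\beta w_1$ with $\alpha,\beta\in\mathbb Z\setminus\{0\}$ is *non-interfering* if $|\beta|\sum_e|w_1(e)|<|\alpha|$ or $|\alpha|\sum_e|w_0(e)|<|\beta|$, where the sums are over the undirected edges of $G$. **Lemma.** Weights $w_0$ and $w_1$ as described exist, and for all such $w_0$,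 $w_1$ and every non-interfering combination $w=\alpha w_0+\beta w_1$, the function $w$ is skew-symmetric and every cycle of $G$ has nonzero circulation with respect to $w$. -/

import Mathlib

/-! ### Skew-symmetric weights and circulations -/

/-- A weight function on the directed edges of `G` (every edge taken in both directions). -/
abbrev EdgeWeight {V : Type*} (G : SimpleGraph V) : Type _ := G.Dart → ℤ

namespace EdgeWeight

variable {V : Type*} {G : SimpleGraph V}

def SkewSymmetric (w : EdgeWeight G) : Prop := ∀ d : G.Dart, w d.symm = -w d

/-- The circulation of a closed walk: the sum of the weights of its directed edges. -/
def circulation (w : EdgeWeight G) {v : V} (C : G.Walk v v) : ℤ := (C.darts.map w).sum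

/-- The sum of the absolute weights of all directed edges; for a skew-symmetric weight this is
twice the total absolute weight of the undirected edges. -/
noncomputable def total (w : EdgeWeight G) : ℤ := ∑ᶠ d : G.Dart, |w d|

/-- The linear combination `α * w₀ + β * w₁` is scaled so that the two weights do not interfere:
both coefficients are nonzero, and the total absolute weight, over the undirected edges, of one of
the two summands is smaller than the scale at which the other one is used. -/
def NonInterfering (w₀ w₁ : EdgeWeight G) (α β : ℤ) : Prop :=
  (β ≠ 0 ∧ |β| * w₁.total < 2 * |α|) ∨ (α ≠ 0 ∧ |α| * w₀.total < 2 * |β|)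

end EdgeWeight

/-! ### Repeated clique-sums and component trees -/

/-- `CliqueSum bag comp I G sep`: the graph `G` is obtained from the component graphs `comp i`,
`i ∈ I`, on the vertex sets `bag i`, by repeated clique-sums along cliques with two or three
vertices, and `sep i τ` says that `τ` is one of the cliques used in these operations and that it was
used to attach component `i`. Identified vertices are represented by the same element of `V`, so the
vertex sets of two operands meet exactly in the shared clique. A clique-sum may delete any edges
between vertices of the shared clique. -/
inductive CliqueSum {V ι : Type*} (bag : ι → Finset V) (comp : ι → SimpleGraph V) :
    Set ι → SimpleGraph V → (ι → Finset V → Prop) → Prop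
  | single (i : ι) : CliqueSum bag comp {i} (comp i) (fun _ _ => False)
  | sum {I₁ I₂ : Set ι} {G₁ G₂ : SimpleGraph V} {sep₁ sep₂ : ι → Finset V → Prop}
      (h₁ : CliqueSum bag comp I₁ G₁ sep₁) (h₂ : CliqueSum bag comp I₂ G₂ sep₂)
      (hI : Disjoint I₁ I₂) (τ : Finset V) (hcard : τ.card = 2 ∨ τ.card = 3)
      (hτ : (⋃ i ∈ I₁, (bag i : Set V)) ∩ (⋃ i ∈ I₂, (bag i : Set V)) = (τ : Set V))
      (hclique₁ : G₁.IsClique (τ : Set V)) (hclique₂ : G₂.IsClique (τ : Set V))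
      (i₁ : ι) (hi₁ : i₁ ∈ I₁) (hsub₁ : τ ⊆ bag i₁)
      (i₂ : ι) (hi₂ : i₂ ∈ I₂) (hsub₂ : τ ⊆ bag i₂)
      (G : SimpleGraph V) (hle : G ≤ G₁ ⊔ G₂)
      (hkeep : ∀ u v : V, (G₁ ⊔ G₂).Adj u v → ¬ (u ∈ τ ∧ v ∈ τ) → G.Adj u v) :
      CliqueSum bag comp (I₁ ∪ I₂) G
        (fun i σ => sep₁ i σ ∨ sep₂ i σ ∨ ((i = i₁ ∨ i = i₂) ∧ σ = τ))

/-- A presentation of `G` as a repeated clique-sum, along cliques with two or three vertices, of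
components indexed by `ι`, together with a choice, for every (real) edge of `G`, of one component in
which it is drawn. -/
structure ComponentTree {V : Type*} (G : SimpleGraph V) (ι : Type*) where
  /-- the vertex set of a component -/
  bag : ι → Finset V
  /-- the component graphs -/
  comp : ι → SimpleGraph V
  comp_adj : ∀ i u v, (comp i).Adj u v → u ∈ bag i ∧ v ∈ bag i
  /-- `sep i τ`: `τ` is a separating set of the component `i` -/
  sep : ι → Finset V → Prop
  cover : ∀ v, ∃ i, v ∈ bag i
  built : CliqueSum bag comp Set.univ G sep
  /-- the component in which a real edge is drawn (there is a choice only for edges of `G` that join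
  two vertices of a separating set) -/
  home : Sym2 V → ι
  home_mem : ∀ u v, G.Adj u v → u ∈ bag (home s(u, v)) ∧ v ∈ bag (home s(u, v))

/-- The directed edges that can occur in a component: a real one, i.e. a directed edge of `G`, or a
virtual one, given by its tail and its head. -/
abbrev Arc {V : Type*} (G : SimpleGraph V) : Type _ := G.Dart ⊕ (V × V)

namespace Arc

variable {V : Type*} {G : SimpleGraph V}

def tail (a : Arc G) : V := Sum.elim (fun d => d.fst) Prod.fst a

/-- Reversal of directed edges. -/
def rev : Equiv.Perm (Arc G) :=
  Function.Involutive.toPerm (Sum.map SimpleGraph.Dart.symm Prod.swap)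
    (by rintro (d | p) <;> simp)

/-- Virtual edges have weight zero. -/
def weight (w : EdgeWeight G) (a : Arc G) : ℤ := Sum.elim w (fun _ => 0) a

end Arc

namespace ComponentTree

variable {V ι : Type*} {G : SimpleGraph V} (D : ComponentTree G ι)

/-- The component tree as a graph: two components are joined if they share a separating set. -/
def tree : SimpleGraph ι where
  Adj i j := i ≠ j ∧ ∃ τ, D.sep i τ ∧ D.sep j τ
  symm := ⟨fun _ _ h => ⟨h.1.symm, h.2.imp fun _ h' => h'.symm⟩⟩
  loopless := ⟨fun _ h => h.1 rfl⟩

/-- The real edges drawn in a component. -/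
def realEdges (i : ι) : Set (Sym2 V) := {e | e ∈ G.edgeSet ∧ D.home e = i}

/-- The directed edges of the component `i`, drawn as a multigraph: the real edges drawn in `i` and
a virtual clique on each of its separating sets. -/
def arcs (i : ι) : Set (Arc G) :=
  {a | (∃ d : G.Dart, a = Sum.inl d ∧ d.edge ∈ D.realEdges i) ∨
    (∃ x y : V, a = Sum.inr (x, y) ∧ x ≠ y ∧ ∃ τ, D.sep i τ ∧ x ∈ τ ∧ y ∈ τ)}

/-- The set `f` of directed edges is the boundary of the virtual triangle on `τ`, traversed in one of
the two directions. -/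
def IsVirtualTriangle (τ : Finset V) (f : Set (Arc G)) : Prop :=
  ∃ x y z : V, x ≠ y ∧ y ≠ z ∧ x ≠ z ∧ (τ : Set V) = {x, y, z} ∧
    f = {Sum.inr (x, y), Sum.inr (y, z), Sum.inr (z, x)}

/-- The faces of the rotation system `rot` on the component `i`, each given by the set of directed
edges met when its boundary is traversed. With `rot` the counterclockwise order at every vertex, the
successor of `a` on the boundary is `rot (rev a)`, the face lies to the right of its directed edges,
and so an inner face is traversed clockwise. A component without edges has one face, with empty
boundary. -/
def faces (i : ι) (rot : Equiv.Perm (Arc G)) : Set (Set (Arc G)) :=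
  {f | (∃ a ∈ D.arcs i, f = {b | (rot * Arc.rev).SameCycle a b}) ∨ (D.arcs i = ∅ ∧ f = ∅)}

/-- A combinatorial planar embedding of the (connected) multigraph of the component `i`: a rotation
system that satisfies Euler's formula, and a choice of the outer face. -/
structure PlaneEmbedding (i : ι) where
  /-- the next directed edge with the same tail, in counterclockwise order -/
  rot : Equiv.Perm (Arc G)
  rot_cycle : ∀ a ∈ D.arcs i, ∀ b, rot.SameCycle a b ↔ b ∈ D.arcs i ∧ b.tail = a.tail
  outer : Set (Arc G)
  outer_mem : outer ∈ D.faces i rot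
  /-- Euler's formula `#vertices + #faces = #edges + 2`, doubled: every edge has two directions. -/
  euler : 2 * ((D.bag i).card + (D.faces i rot).ncard) = (D.arcs i).ncard + 4

variable {D}

def PlaneEmbedding.IsInnerFace {i : ι} (E : D.PlaneEmbedding i) (f : Set (Arc G)) : Prop :=
  f ∈ D.faces i E.rot ∧ f ≠ E.outer

end ComponentTree

/-- The circulation of a face in the clockwise direction. -/
noncomputable def faceCirculation {V : Type*} {G : SimpleGraph V} (w : EdgeWeight G)
    (f : Set (Arc G)) : ℤ := ∑ᶠ a ∈ f, Arc.weight w a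

/-! ### The working tree

`center A` is the center chosen in the subtree with node set `A`. The nodes of the working tree are
in bijection with the node sets `A` met in the recursion (the "pieces"): the piece `A` stands for the
subtree of the working tree with node set `A`, whose root is `center A`. -/

namespace WorkingTree

variable {ι : Type*} (S : SimpleGraph ι) (center : Set ι → ι)

/-- `B` is one of the connected pieces into which `A` falls when its center is deleted. -/
def Child (A B : Set ι) : Prop :=
  ∃ C : (S.induce (A \ {center A})).ConnectedComponent, B = Subtype.val '' C.supp

/-- `B` is `A` or is met in the recursion below `A`. -/
def Below (A B : Set ι) : Prop := Relation.ReflTransGen (Child S center) A B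

def Piece (A : Set ι) : Prop := Below S center Set.univ A

/-- The level of (the root of) a piece: the number of nodes on the path from the root. -/
noncomputable def level (A : Set ι) : ℕ :=
  {B : Set ι | Piece S center B ∧ Below S center B A}.ncard

noncomputable def maxLevel : ℕ := sSup {k | ∃ A, Piece S center A ∧ level S center A = k}

noncomputable def height (A : Set ι) : ℕ := maxLevel S center + 1 - level S center A

/-- The number of leaves of the subtree with node set `A`. -/
noncomputable def leaves (A : Set ι) : ℕ :=
  {B : Set ι | Below S center A B ∧ ∀ B', ¬ Child S center B B'}.ncard

end WorkingTree

/-! ### The weighting scheme -/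

namespace ComponentTree

open WorkingTree

variable {V ι : Type*} {G : SimpleGraph V} (D : ComponentTree G ι)

/-- The face `f` of the component `center A` is adjacent to the virtual edge or virtual triangle at
which the subtree with node set `B` is attached to `center A`. -/
def AdjacentToAttachment (center : Set ι → ι) (A B : Set ι) (f : Set (Arc G)) : Prop :=
  ∃ τ, D.sep (center A) τ ∧ (∃ j ∈ B, D.sep j τ) ∧ ∃ x ∈ τ, ∃ y ∈ τ, Sum.inr (x, y) ∈ f

/-- The circulation that `w₀` gives to the face `f` of the planar component `center A`. -/
noncomputable def prescribed (K : ℕ) (center : Set ι → ι) (A : Set ι) (f : Set (Arc G)) : ℤ :=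
  ∑ᶠ B ∈ {B | Child D.tree center A B ∧ D.AdjacentToAttachment center A B f},
    2 * (K : ℤ) ^ height D.tree center B * (leaves D.tree center B : ℤ)

/-- `w` is a weight `w₀`. Planar components (those in `P`): inner faces, other than the virtual
triangles, have the prescribed circulations. Other components: the real edges are numbered
`1, 2, …`, and the edge with number `j` has weight `2 ^ j * K ^ (h - 1) * l` in one direction. -/
def IsW₀ (P : Set ι) (emb : ∀ i ∈ P, D.PlaneEmbedding i) (K : ℕ) (center : Set ι → ι)
    (w : EdgeWeight G) : Prop :=
  w.SkewSymmetric ∧ ∀ A, Piece D.tree center A →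
    (∀ hP : center A ∈ P, ∀ f, (emb (center A) hP).IsInnerFace f →
      (¬ ∃ τ, D.sep (center A) τ ∧ IsVirtualTriangle τ f) →
      faceCirculation w f = D.prescribed K center A f) ∧
    (center A ∉ P → ∃ num : Sym2 V → ℕ,
      Set.BijOn num (D.realEdges (center A)) (Set.Icc 1 (D.realEdges (center A)).ncard) ∧
      ∀ d : G.Dart, d.edge ∈ D.realEdges (center A) →
        |w d| = 2 ^ num d.edge * (K : ℤ) ^ (height D.tree center A - 1) *
          (leaves D.tree center A : ℤ))

/-- `w` is a weight `w₁`. Planar components: inner faces, other than the virtual triangles, have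
circulation `1`. Other components: all real edges have weight `0`. -/
def IsW₁ (P : Set ι) (emb : ∀ i ∈ P, D.PlaneEmbedding i) (w : EdgeWeight G) : Prop :=
  w.SkewSymmetric ∧
    (∀ i (hi : i ∈ P) f, (emb i hi).IsInnerFace f →
      (¬ ∃ τ, D.sep i τ ∧ IsVirtualTriangle τ f) → faceCirculation w f = 1) ∧
    (∀ i ∉ P, ∀ d : G.Dart, d.edge ∈ D.realEdges i → w d = 0)

end ComponentTree

/-! ### The structure of repeated clique-sums -/

namespace CliqueSum

variable {V ι : Type*} {bag : ι → Finset V} {comp : ι → SimpleGraph V} {I : Set ι}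
  {G : SimpleGraph V} {sep : ι → Finset V → Prop}

/-! Deleting centers one after the other, one reaches a subtree of the working tree that contains
every component in which a given cycle has edges and whose root `N` is one of them
(`exists_piece_of_cycle`). Under `w₀` the edges in the root outweigh all edges below it, unless the
cycle stays inside a planar `N`; in that case `w₁` decides.

Trace of the cycle on `N`: an excursion out of `N` leaves and returns through a single separating
set, so a virtual edge of weight zero can replace it, and a simple cycle of `N` results. If `N` is
planar, its weight is, up to sign, the sum of the circulations of the faces inside. These are
nonnegative for `w₀`, so nothing cancels and the absolute value is the sum of `2 * scale B * t B`
over the attached subtrees `B`, where `t B` counts the inside faces, other than virtual triangles,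
adjacent to the attachment of `B`. Always `t B ≤ 3`, and `t B ≥ 1` if the cycle enters `B`
(`abs_part_planar`). If `N` is not planar, distinct powers of two cannot cancel.

The upper bounds show, from the leaves to the root, that the part of a cycle in any subtree is
smaller than the scale `K ^ h * l` of that subtree (`abs_part_lt_scale`). The lower bounds then make
the root dominate (`sum_ne_zero_or_sum_ne_zero`). Inside a planar component, `w₁` counts the
nonvirtual faces inside the cycle, and there is at least one.

The Jordan curve theorem needed here (`exists_interior`) comes from Euler's formula by linear
algebra: gradients of vertex functions and differences of face functions are orthogonal, and their
dimensions add up to the number of edges. A cycle is orthogonal to all gradients, so it is the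
difference of a face function, and this function takes two values only.

The weights exist because every face other than a virtual triangle is reached from the outer face
across real edges, so circulation can be shipped to it (`exists_weight`), and because each real edge
is drawn in one component only. -/

theorem sep_spec (h : CliqueSum bag comp I G sep) :
    ∀ i σ, sep i σ → i ∈ I ∧ σ ⊆ bag i ∧ (σ.card = 2 ∨ σ.card = 3) := by
  induction h with
  | single i => intro _ _ h; exact h.elim
  | sum h₁ h₂ hI τ hcard hτ hc₁ hc₂ i₁ hi₁ hsub₁ i₂ hi₂ hsub₂ G hle hkeep ih₁ ih₂ =>
    rintro i σ (h | h | ⟨h | h, h'⟩)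
    · exact ⟨Or.inl (ih₁ i σ h).1, (ih₁ i σ h).2⟩
    · exact ⟨Or.inr (ih₂ i σ h).1, (ih₂ i σ h).2⟩
    · subst h h'; exact ⟨Or.inl hi₁, hsub₁, hcard⟩
    · subst h h'; exact ⟨Or.inr hi₂, hsub₂, hcard⟩

/-- `br` assigns to every component other than `N` the separating set of `N` behind which it
lies. -/
structure IsBranching (bag : ι → Finset V) (I : Set ι) (sep : ι → Finset V → Prop) (N : ι)
    (br : ι → Finset V) : Prop where
  sep_br : ∀ i ∈ I, i ≠ N → sep N (br i)
  inter : ∀ i ∈ I, i ≠ N → ∀ v ∈ bag i, v ∈ bag N → v ∈ br i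
  congr : ∀ i ∈ I, i ≠ N → ∀ j ∈ I, j ≠ N → ∀ v ∈ bag i, v ∈ bag j → br i = br j

/-- Extension of a branching when a second operand `I₂` is attached at the component `i₁`. -/
theorem IsBranching.extend {I₁ I₂ : Set ι} {sep₁ : ι → Finset V → Prop} {N : ι}
    {br : ι → Finset V} (h : IsBranching bag I₁ sep₁ N br) (hN : N ∈ I₁) (hI : Disjoint I₁ I₂)
    (hmono : ∀ i σ, sep₁ i σ → sep i σ) {τ : Finset V}
    (hone : ∀ i σ τ v, sep i σ → sep i τ → v ∈ σ → v ∈ τ → σ = τ)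
    (hτ : (⋃ i ∈ I₁, (bag i : Set V)) ∩ (⋃ i ∈ I₂, (bag i : Set V)) = (τ : Set V))
    {i₁ : ι} (hi₁ : i₁ ∈ I₁) (hsub : τ ⊆ bag i₁) (hsep : sep i₁ τ) :
    ∃ br', IsBranching bag (I₁ ∪ I₂) sep N br' := by
  classical
  have hmeet : ∀ i ∈ I₁, ∀ j ∈ I₂, ∀ v ∈ bag i, v ∈ bag j → v ∈ τ := by
    intro i hi j hj v hv hv'
    have : v ∈ (τ : Set V) := by
      rw [← hτ]
      exact ⟨Set.mem_biUnion hi hv, Set.mem_biUnion hj hv'⟩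
    exact this
  have hnot : ∀ j ∈ I₂, j ∉ I₁ := fun j hj hj' => Set.disjoint_left.1 hI hj' hj
  -- Seen from `N`, all of `I₂` lies behind the same set as `i₁`, where it is attached, or behind
  -- `τ` itself if `i₁ = N`.
  set ν : Finset V := if i₁ = N then τ else br i₁ with hν
  have hν_sep : sep N ν := by
    by_cases h1 : i₁ = N
    · subst h1; simpa [hν] using hsep
    · simpa [hν, h1] using hmono _ _ (h.sep_br i₁ hi₁ h1)
  have cross : ∀ i ∈ I₁, i ≠ N → ∀ v ∈ bag i, v ∈ τ → br i = ν := by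
    intro i hi hiN v hv hvτ
    by_cases h1 : i₁ = N
    · subst h1
      have := hone i₁ (br i) τ v (hmono _ _ (h.sep_br i hi hiN)) hsep
        (h.inter i hi hiN v hv (hsub hvτ)) hvτ
      simpa [hν] using this
    · simpa [hν, h1] using h.congr i hi hiN i₁ hi₁ h1 v hv (hsub hvτ)
  refine ⟨fun i => if i ∈ I₁ then br i else ν, ?_, ?_, ?_⟩
  · rintro i (hi | hi) hiN
    · simpa [hi] using hmono _ _ (h.sep_br i hi hiN)
    · simpa [hnot i hi] using hν_sep
  · rintro i (hi | hi) hiN v hv hvN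
    · simpa [hi] using h.inter i hi hiN v hv hvN
    · have hvτ := hmeet N hN i hi v hvN hv
      simp only [hnot i hi, if_false]
      by_cases h1 : i₁ = N
      · simpa [hν, h1] using hvτ
      · simpa [hν, h1] using h.inter i₁ hi₁ h1 v (hsub hvτ) hvN
  · rintro i (hi | hi) hiN j (hj | hj) hjN v hv hv'
    · simpa [hi, hj] using h.congr i hi hiN j hj hjN v hv hv'
    · simpa [hi, hnot j hj] using cross i hi hiN v hv (hmeet i hi j hj v hv hv')
    · simpa [hj, hnot i hi] using (cross j hj hjN v hv' (hmeet j hj i hi v hv' hv)).symm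
    · simp [hnot i hi, hnot j hj]

/-- `N` lies in one of the two operands, and the other one hangs on that operand at a single
component, the situation of `IsBranching.extend`. -/
theorem exists_branching (h : CliqueSum bag comp I G sep)
    (hone : ∀ i σ τ v, sep i σ → sep i τ → v ∈ σ → v ∈ τ → σ = τ) :
    ∀ N ∈ I, ∃ br, IsBranching bag I sep N br := by
  induction h with
  | single i =>
    rintro N rfl
    exact ⟨fun _ => ∅, fun i hi h => (h hi).elim, fun i hi h => (h hi).elim,
      fun i hi h => (h hi).elim⟩
  | @sum I₁ I₂ G₁ G₂ sep₁ sep₂ h₁ h₂ hI τ hcard hτ hc₁ hc₂ i₁ hi₁ hsub₁ i₂ hi₂ hsub₂ G hle hkeep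
      ih₁ ih₂ =>
    rintro N (hN | hN)
    · obtain ⟨br, hbr⟩ := ih₁ (fun i σ τ v h h' => hone i σ τ v (Or.inl h) (Or.inl h')) N hN
      exact hbr.extend hN hI (fun _ _ h => Or.inl h) hone hτ hi₁ hsub₁
        (Or.inr (Or.inr ⟨Or.inl rfl, rfl⟩))
    · obtain ⟨br, hbr⟩ := ih₂ (fun i σ τ v h h' => hone i σ τ v (Or.inr (Or.inl h))
        (Or.inr (Or.inl h'))) N hN
      rw [Set.union_comm]
      exact hbr.extend hN hI.symm (fun _ _ h => Or.inr (Or.inl h)) hone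
        (by rw [Set.inter_comm]; exact hτ) hi₂ hsub₂ (Or.inr (Or.inr ⟨Or.inr rfl, rfl⟩))

theorem reflTransGen_sep (h : CliqueSum bag comp I G sep) :
    ∀ i ∈ I, ∀ j ∈ I, Relation.ReflTransGen
      (fun a b => a ≠ b ∧ ∃ τ, sep a τ ∧ sep b τ) i j := by
  induction h with
  | single i => rintro _ rfl _ rfl; exact .refl
  | @sum I₁ I₂ G₁ G₂ sep₁ sep₂ h₁ h₂ hI τ hcard hτ hc₁ hc₂ i₁ hi₁ hsub₁ i₂ hi₂ hsub₂ G hle hkeep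
      ih₁ ih₂ =>
    have l : ∀ i ∈ I₁, ∀ j ∈ I₁, Relation.ReflTransGen (fun a b => a ≠ b ∧ ∃ σ,
        (sep₁ a σ ∨ sep₂ a σ ∨ ((a = i₁ ∨ a = i₂) ∧ σ = τ)) ∧
        (sep₁ b σ ∨ sep₂ b σ ∨ ((b = i₁ ∨ b = i₂) ∧ σ = τ))) i j := fun i hi j hj =>
      Relation.ReflTransGen.mono (fun a b ⟨h, σ, h', h''⟩ => ⟨h, σ, Or.inl h', Or.inl h''⟩) _ _
        (ih₁ i hi j hj)
    have r : ∀ i ∈ I₂, ∀ j ∈ I₂, Relation.ReflTransGen (fun a b => a ≠ b ∧ ∃ σ,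
        (sep₁ a σ ∨ sep₂ a σ ∨ ((a = i₁ ∨ a = i₂) ∧ σ = τ)) ∧
        (sep₁ b σ ∨ sep₂ b σ ∨ ((b = i₁ ∨ b = i₂) ∧ σ = τ))) i j := fun i hi j hj =>
      Relation.ReflTransGen.mono (fun a b ⟨h, σ, h', h''⟩ =>
        ⟨h, σ, Or.inr (Or.inl h'), Or.inr (Or.inl h'')⟩) _ _ (ih₂ i hi j hj)
    have hne : i₁ ≠ i₂ := fun h => Set.disjoint_left.1 hI hi₁ (h ▸ hi₂)
    rintro i (hi | hi) j (hj | hj)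
    · exact l i hi j hj
    · exact ((l i hi i₁ hi₁).tail ⟨hne, τ, by simp, by simp⟩).trans (r i₂ hi₂ j hj)
    · exact ((r i hi i₂ hi₂).tail ⟨hne.symm, τ, by simp, by simp⟩).trans (l i₁ hi₁ j hj)
    · exact r i hi j hj

end CliqueSum

/-! ### Directed edges, real and virtual -/

namespace Arc

variable {V : Type*} {G : SimpleGraph V}

/-- The end of a directed edge. -/
def head (a : Arc G) : V := (rev a).tail

@[simp] theorem rev_inl (d : G.Dart) : rev (Sum.inl d : Arc G) = Sum.inl d.symm := rfl
@[simp] theorem rev_inr (x y : V) : rev (Sum.inr (x, y) : Arc G) = Sum.inr (y, x) := rfl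
@[simp] theorem rev_rev (a : Arc G) : rev (rev a) = a := by
  rcases a with d | ⟨x, y⟩ <;> simp
@[simp] theorem tail_inl (d : G.Dart) : tail (Sum.inl d : Arc G) = d.fst := rfl
@[simp] theorem tail_inr (x y : V) : tail (Sum.inr (x, y) : Arc G) = x := rfl
@[simp] theorem head_inl (d : G.Dart) : head (Sum.inl d : Arc G) = d.snd := rfl
@[simp] theorem head_inr (x y : V) : head (Sum.inr (x, y) : Arc G) = y := rfl
@[simp] theorem tail_rev (a : Arc G) : tail (rev a) = head a := rfl
@[simp] theorem head_rev (a : Arc G) : head (rev a) = tail a := by simp [head]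
@[simp] theorem weight_inl (w : EdgeWeight G) (d : G.Dart) :
    weight w (Sum.inl d) = w d := rfl
@[simp] theorem weight_inr (w : EdgeWeight G) (p : V × V) :
    weight w (Sum.inr p) = 0 := rfl

theorem weight_rev {w : EdgeWeight G} (hw : w.SkewSymmetric) (a : Arc G) :
    weight w (rev a) = -weight w a := by
  rcases a with d | ⟨x, y⟩
  · simpa using hw d
  · simp

end Arc

/-! ### The multigraph of a component and its connectedness -/

namespace ComponentTree

variable {V ι : Type*} {G : SimpleGraph V} {D : ComponentTree G ι} {i : ι}

theorem sep_subset_bag {τ : Finset V} (h : D.sep i τ) : τ ⊆ D.bag i :=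
  (D.built.sep_spec i τ h).2.1

theorem sep_card {τ : Finset V} (h : D.sep i τ) : τ.card = 2 ∨ τ.card = 3 :=
  (D.built.sep_spec i τ h).2.2

theorem sep_nonempty {τ : Finset V} (h : D.sep i τ) : τ.Nonempty := by
  rw [← Finset.card_pos]; rcases sep_card h with h | h <;> omega

theorem inl_mem_arcs {d : G.Dart} : Sum.inl d ∈ D.arcs i ↔ D.home d.edge = i := by
  simp [arcs, realEdges]

theorem inr_mem_arcs {x y : V} :
    Sum.inr (x, y) ∈ D.arcs i ↔ x ≠ y ∧ ∃ τ, D.sep i τ ∧ x ∈ τ ∧ y ∈ τ := by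
  constructor
  · rintro (⟨d, h, -⟩ | ⟨x', y', h, h'⟩)
    · cases h
    · cases h; exact h'
  · exact fun h => Or.inr ⟨x, y, rfl, h⟩

theorem rev_mem_arcs {a : Arc G} (h : a ∈ D.arcs i) : Arc.rev a ∈ D.arcs i := by
  rcases a with d | ⟨x, y⟩
  · simpa [inl_mem_arcs] using h
  · rw [inr_mem_arcs] at h
    rw [Arc.rev_inr, inr_mem_arcs]
    obtain ⟨h, τ, h1, h2, h3⟩ := h
    exact ⟨h.symm, τ, h1, h3, h2⟩

theorem tail_ne_head {a : Arc G} (h : a ∈ D.arcs i) : a.tail ≠ a.head := by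
  rcases a with d | ⟨x, y⟩
  · simp [d.fst_ne_snd]
  · exact (inr_mem_arcs.1 h).1

theorem rev_ne {a : Arc G} (h : a ∈ D.arcs i) : Arc.rev a ≠ a := fun h' =>
  tail_ne_head h (by conv_lhs => rw [← h', Arc.tail_rev])

theorem home_mem_bag (d : G.Dart) : d.fst ∈ D.bag (D.home d.edge) ∧
    d.snd ∈ D.bag (D.home d.edge) := by
  simpa [SimpleGraph.Dart.edge] using D.home_mem d.fst d.snd d.adj

theorem tail_mem_bag {a : Arc G} (h : a ∈ D.arcs i) : a.tail ∈ D.bag i := by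
  rcases a with d | ⟨x, y⟩
  · rw [inl_mem_arcs] at h
    subst h
    exact (home_mem_bag d).1
  · obtain ⟨-, τ, h1, h2, -⟩ := inr_mem_arcs.1 h
    exact sep_subset_bag h1 h2

theorem head_mem_bag {a : Arc G} (h : a ∈ D.arcs i) : a.head ∈ D.bag i :=
  tail_mem_bag (rev_mem_arcs h)

/-- Every component has a function which assigns to each other component the separating set behind
which it lies. -/
theorem exists_branching (hone : ∀ i σ τ v, D.sep i σ → D.sep i τ → v ∈ σ → v ∈ τ → σ = τ)
    (N : ι) : ∃ br, CliqueSum.IsBranching D.bag Set.univ D.sep N br :=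
  D.built.exists_branching hone N trivial

theorem tree_preconnected (i j : ι) : Relation.ReflTransGen D.tree.Adj i j :=
  D.built.reflTransGen_sep i trivial j trivial

/-- Two vertices joined by a directed edge of the component `i`. -/
def Link (D : ComponentTree G ι) (i : ι) (u v : V) : Prop :=
  ∃ a ∈ D.arcs i, a.tail = u ∧ a.head = v

/-- The multigraph drawn in a component is connected. -/
theorem link_connected (hG : G.Connected)
    (hone : ∀ i σ τ v, D.sep i σ → D.sep i τ → v ∈ σ → v ∈ τ → σ = τ)
    {u v : V} (hu : u ∈ D.bag i) (hv : v ∈ D.bag i) : Relation.ReflTransGen (D.Link i) u v := by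
  obtain ⟨br, hbr⟩ := exists_branching hone i
  have virt : ∀ {x y : V} {τ}, D.sep i τ → x ∈ τ → y ∈ τ →
      Relation.ReflTransGen (D.Link i) x y := by
    intro x y τ hτ hx hy
    by_cases h : x = y
    · subst h; exact .refl
    · exact .single ⟨Sum.inr (x, y), inr_mem_arcs.2 ⟨h, τ, hτ, hx, hy⟩, rfl, rfl⟩
  -- Invariant along a walk in `G`: outside the bag, some vertex of the separating set behind which
  -- the walk runs is linked to `u`. The walk can only return through that set, whose vertices are
  -- joined by virtual edges.
  have key : ∀ x, Relation.ReflTransGen G.Adj u x →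
      (x ∈ D.bag i ∧ Relation.ReflTransGen (D.Link i) u x) ∨
      (x ∉ D.bag i ∧ ∃ j ≠ i, x ∈ D.bag j ∧ ∃ y ∈ br j,
        Relation.ReflTransGen (D.Link i) u y) := by
    intro x hx
    induction hx with
    | refl => exact Or.inl ⟨hu, .refl⟩
    | @tail x z _ hxz ih =>
      have hm := D.home_mem x z hxz
      by_cases hj : D.home s(x, z) = i
      · rw [hj] at hm
        rcases ih with ⟨-, h⟩ | ⟨h, -⟩
        · exact Or.inl ⟨hm.2, h.tail ⟨Sum.inl ⟨(x, z), hxz⟩, inl_mem_arcs.2 hj, rfl, rfl⟩⟩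
        · exact (h hm.1).elim
      · have hs := hbr.sep_br _ trivial hj
        have : ∃ y ∈ br (D.home s(x, z)), Relation.ReflTransGen (D.Link i) u y := by
          rcases ih with ⟨hx, h⟩ | ⟨-, j, hji, hxj, h⟩
          · exact ⟨x, hbr.inter _ trivial hj x hm.1 hx, h⟩
          · rwa [← hbr.congr j trivial hji _ trivial hj x hxj hm.1]
        by_cases hz : z ∈ D.bag i
        · obtain ⟨y, hy, h⟩ := this
          exact Or.inl ⟨hz, h.trans (virt hs hy (hbr.inter _ trivial hj z hm.2 hz))⟩
        · exact Or.inr ⟨hz, _, hj, hm.2, this⟩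
  have hr : Relation.ReflTransGen G.Adj u v :=
    (SimpleGraph.reachable_iff_reflTransGen u v).1 (hG.preconnected u v)
  rcases key v hr with ⟨-, h⟩ | ⟨h, -⟩
  · exact h
  · exact (h hv).elim

end ComponentTree

/-! ### Linear algebra for Euler's formula -/

/-- Orthogonality of gradients and face differences: `t` is a vertex function read at the tail, `q`
a face function, `step` the successor on a face. The four sums of the expanded product agree after
reindexing by `rev` and `step`. -/
theorem sum_gradient_mul_boundary {A : Type*} [Fintype A] (rev step : Equiv.Perm A)
    (hrev : ∀ a, rev (rev a) = a) (t q : A → ℚ) (ht : ∀ a, t (step a) = t (rev a))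
    (hq : ∀ a, q (step a) = q a) :
    ∑ a, (t (rev a) - t a) * (q a - q (rev a)) = 0 := by
  have e1 : ∑ a, t (rev a) * q a = ∑ a, t a * q (rev a) := by
    rw [← Equiv.sum_comp rev (fun a => t (rev a) * q a)]
    simp [hrev]
  have e2 : ∑ a, t (rev a) * q (rev a) = ∑ a, t a * q a :=
    Equiv.sum_comp rev (fun a => t a * q a)
  have e3 : ∑ a, t a * q a = ∑ a, t (rev a) * q a := by
    rw [← Equiv.sum_comp step (fun a => t a * q a)]
    simp [ht, hq]
  simp only [sub_mul, mul_sub, Finset.sum_sub_distrib]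
  linarith

/-- Skew-symmetric functions have at most half the dimension of all functions. -/
theorem two_mul_finrank_skew_le {A : Type*} [Fintype A] [LinearOrder A] (rev : Equiv.Perm A)
    (hrev : ∀ a, rev (rev a) = a) (hne : ∀ a, rev a ≠ a) (S : Submodule ℚ (A → ℚ))
    (hS : ∀ c ∈ S, ∀ a, c (rev a) = -c a) :
    2 * Module.finrank ℚ S ≤ Fintype.card A := by
  -- An orientation. Multiplication by the skew function `σ` turns skew-symmetric functions into
  -- symmetric ones, and only zero is both; so `S` and its image are independent subspaces of equal
  -- dimension.
  let σ : A → ℚ := fun a => if a < rev a then 1 else -1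
  have hσ : ∀ a, σ (rev a) = -σ a := by
    intro a
    simp only [σ, hrev]
    rcases lt_or_gt_of_ne (hne a) with h | h
    · simp [h, h.not_gt]
    · simp [h, h.not_gt]
  have hσ2 : ∀ a, σ a * σ a = 1 := by
    intro a; simp only [σ]; split_ifs <;> norm_num
  let f : (A → ℚ) ≃ₗ[ℚ] (A → ℚ) :=
    LinearEquiv.ofInvolutive
      { toFun := fun c a => σ a * c a
        map_add' := fun c d => by ext a; simp [mul_add]
        map_smul' := fun r c => by ext a; simp; ring }
      (fun c => by ext a; simp [← mul_assoc, hσ2])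
  have hfr : Module.finrank ℚ (S.map f.toLinearMap) = Module.finrank ℚ S :=
    LinearEquiv.finrank_map_eq f S
  have hdisj : Disjoint S (S.map f.toLinearMap) := by
    rw [Submodule.disjoint_def]
    rintro c hc ⟨d, hd, rfl⟩
    ext a
    have h1 := hS _ hc a
    have h2 : f.toLinearMap d (rev a) = f.toLinearMap d a := by
      change σ (rev a) * d (rev a) = σ a * d a
      rw [hσ, hS d hd]; ring
    simp only [Pi.zero_apply]
    linarith
  have := Submodule.finrank_add_finrank_le_of_disjoint hdisj
  rw [hfr, Module.finrank_pi] at this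
  omega

instance SimpleGraph.Dart.instFinite {V : Type*} [Finite V] (G : SimpleGraph V) :
    Finite G.Dart :=
  Finite.of_injective (fun d => d.toProd) (fun _ _ h => SimpleGraph.Dart.ext _ _ h)

/-! ### Rotations and faces -/

namespace ComponentTree.PlaneEmbedding

variable {V ι : Type*} {G : SimpleGraph V} {D : ComponentTree G ι} {i : ι}
  (E : D.PlaneEmbedding i)

/-- The face to the right of a directed edge. -/
def face (a : Arc G) : Set (Arc G) := {b | (E.rot * Arc.rev).SameCycle a b}

theorem mem_face (a : Arc G) : a ∈ E.face a := Equiv.Perm.SameCycle.refl _ _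

theorem face_eq_of_mem {a b : Arc G} (h : b ∈ E.face a) : E.face b = E.face a := by
  ext c
  exact ⟨fun h' => Equiv.Perm.SameCycle.trans h h', fun h' =>
    Equiv.Perm.SameCycle.trans (Equiv.Perm.SameCycle.symm h) h'⟩

theorem face_rot_rev (a : Arc G) : E.face (E.rot (Arc.rev a)) = E.face a := by
  apply E.face_eq_of_mem
  exact Equiv.Perm.sameCycle_apply_right.2 (Equiv.Perm.SameCycle.refl _ _)

theorem face_rot (a : Arc G) : E.face (E.rot a) = E.face (Arc.rev a) := by
  rw [← E.face_rot_rev (Arc.rev a), Arc.rev_rev]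

theorem rot_spec {a : Arc G} (h : a ∈ D.arcs i) :
    E.rot a ∈ D.arcs i ∧ (E.rot a).tail = a.tail :=
  (E.rot_cycle a h _).1 (Equiv.Perm.sameCycle_apply_right.2 (Equiv.Perm.SameCycle.refl _ _))

theorem rot_mem_arcs_iff {a : Arc G} : E.rot a ∈ D.arcs i ↔ a ∈ D.arcs i :=
  ⟨fun h => ((E.rot_cycle _ h a).1
    (Equiv.Perm.sameCycle_apply_left.2 (Equiv.Perm.SameCycle.refl _ _))).1,
    fun h => (E.rot_spec h).1⟩

theorem rev_mem_arcs_iff {a : Arc G} : Arc.rev a ∈ D.arcs i ↔ a ∈ D.arcs i :=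
  ⟨fun h => by simpa using rev_mem_arcs h, rev_mem_arcs⟩

theorem face_mem_faces {a : Arc G} (h : a ∈ D.arcs i) : E.face a ∈ D.faces i E.rot :=
  Or.inl ⟨a, h, rfl⟩

theorem exists_eq_face (hne : (D.arcs i).Nonempty) {f : Set (Arc G)}
    (h : f ∈ D.faces i E.rot) : ∃ a ∈ D.arcs i, f = E.face a := by
  rcases h with h | ⟨h, -⟩
  · exact h
  · exact (hne.ne_empty h).elim

variable [Finite V]

theorem face_induction {p : Arc G → Prop} {a b : Arc G} (h : b ∈ E.face a) (ha : p a)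
    (hp : ∀ c, p c → p (E.rot (Arc.rev c))) : p b := by
  obtain ⟨n, rfl⟩ := Equiv.Perm.SameCycle.exists_nat_pow_eq h
  clear h
  induction n with
  | zero => simpa using ha
  | succ n ih => rw [pow_succ']; exact hp _ ih

theorem rot_induction {p : Arc G → Prop} {a b : Arc G} (ha : a ∈ D.arcs i) (hb : b ∈ D.arcs i)
    (h : b.tail = a.tail) (hpa : p a) (hp : ∀ c ∈ D.arcs i, p c → p (E.rot c)) : p b := by
  obtain ⟨n, rfl⟩ := Equiv.Perm.SameCycle.exists_nat_pow_eq ((E.rot_cycle a ha b).2 ⟨hb, h⟩)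
  clear h hb
  have : (E.rot ^ n) a ∈ D.arcs i ∧ p ((E.rot ^ n) a) := by
    induction n with
    | zero => exact ⟨ha, hpa⟩
    | succ n ih => rw [pow_succ']; exact ⟨E.rot_mem_arcs_iff.2 ih.1, hp _ ih.1 ih.2⟩
  exact this.2

theorem face_subset_arcs {a : Arc G} (h : a ∈ D.arcs i) : E.face a ⊆ D.arcs i := fun _ hb =>
  E.face_induction hb h (fun _ hc => E.rot_mem_arcs_iff.2 (rev_mem_arcs hc))

theorem eq_face_of_mem {f : Set (Arc G)} (hf : f ∈ D.faces i E.rot) {a : Arc G} (h : a ∈ f) :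
    a ∈ D.arcs i ∧ f = E.face a := by
  rcases hf with ⟨b, hb, rfl⟩ | ⟨-, rfl⟩
  · exact ⟨E.face_subset_arcs hb h, (E.face_eq_of_mem h).symm⟩
  · exact h.elim

/-- Every two directed edges of a connected component are linked by rotations and reversals. -/
theorem arc_induction
    (hconn : ∀ u ∈ D.bag i, ∀ v ∈ D.bag i, Relation.ReflTransGen (D.Link i) u v)
    {p : Arc G → Prop} {a b : Arc G} (ha : a ∈ D.arcs i) (hb : b ∈ D.arcs i) (hpa : p a)
    (hrev : ∀ c ∈ D.arcs i, p c → p (Arc.rev c))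
    (hrot : ∀ c ∈ D.arcs i, p c → p (E.rot c)) : p b := by
  have key : ∀ v, Relation.ReflTransGen (D.Link i) a.tail v →
      ∀ c ∈ D.arcs i, c.tail = v → p c := by
    intro v hv
    induction hv with
    | refl => exact fun c hc h => E.rot_induction ha hc h hpa hrot
    | tail _ h ih =>
      obtain ⟨e, he, h1, h2⟩ := h
      exact fun c hc h => E.rot_induction (rev_mem_arcs he) hc (by rw [h, ← h2, Arc.tail_rev])
        (hrev e he (ih e he h1)) hrot
  exact key _ (hconn _ (tail_mem_bag ha) _ (tail_mem_bag hb)) b hb rfl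

/-- A function of the faces does not change around a vertex as long as no directed edge is met at
which it changes. -/
theorem rotation_const {β : Type*} (g : Set (Arc G) → β) {a b : Arc G} (ha : a ∈ D.arcs i)
    (hb : b ∈ D.arcs i) (hab : a.head = b.tail)
    (hg : ∀ e ∈ D.arcs i, e.tail = b.tail → e ≠ b → e ≠ Arc.rev a →
      g (E.face e) = g (E.face (Arc.rev e))) :
    g (E.face a) = g (E.face b) := by
  classical
  have ha' := rev_mem_arcs ha
  -- The exponent has to be positive: for `b = rev a` a full turn around the vertex is meant.
  have hex : ∃ n : ℕ, 0 < n ∧ (E.rot ^ n) (Arc.rev a) = b := by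
    obtain ⟨n, hn⟩ := Equiv.Perm.SameCycle.exists_nat_pow_eq
      ((E.rot_cycle _ ha' b).2 ⟨hb, by simp [hab]⟩)
    refine ⟨n + orderOf E.rot, by have := orderOf_pos E.rot; omega, ?_⟩
    rw [pow_add, pow_orderOf_eq_one, mul_one, hn]
  set J := Nat.find hex with hJ
  obtain ⟨hJ0, hJb⟩ : 0 < J ∧ (E.rot ^ J) (Arc.rev a) = b := Nat.find_spec hex
  have hmin : ∀ n < J, 0 < n → (E.rot ^ n) (Arc.rev a) ≠ b :=
    fun n hn h0 h => Nat.find_min hex hn ⟨h0, h⟩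
  have hmem : ∀ n : ℕ, (E.rot ^ n) (Arc.rev a) ∈ D.arcs i ∧
      ((E.rot ^ n) (Arc.rev a)).tail = b.tail := by
    intro n
    induction n with
    | zero => exact ⟨ha', by simp [hab]⟩
    | succ n ih =>
      rw [pow_succ']
      exact ⟨(E.rot_spec ih.1).1, (E.rot_spec ih.1).2.trans ih.2⟩
  have hno : ∀ n, 0 < n → n < J → (E.rot ^ n) (Arc.rev a) ≠ Arc.rev a := by
    intro n h0 hn h
    apply hmin (J - n) (by omega) (by omega)
    have : (E.rot ^ (J - n)) ((E.rot ^ n) (Arc.rev a)) = b := by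
      rw [← Equiv.Perm.mul_apply, ← pow_add, Nat.sub_add_cancel hn.le, hJb]
    rwa [h] at this
  -- The first rotation from `rev a` leads to the face of `a`. Each later one crosses a single
  -- directed edge, which is neither `b` nor `rev a`.
  have key : ∀ n, n < J → g (E.face ((E.rot ^ (n + 1)) (Arc.rev a))) = g (E.face a) := by
    intro n
    induction n with
    | zero => intro _; simp [E.face_rot_rev]
    | succ n ih =>
      intro hn
      rw [pow_succ', Equiv.Perm.mul_apply, E.face_rot, ← ih (by omega)]
      have := hmem (n + 1)
      exact (hg _ this.1 this.2 (hmin _ hn (by omega)) (hno _ (by omega) hn)).symm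
  have := key (J - 1) (by omega)
  rw [Nat.sub_add_cancel (by omega), hJb] at this
  exact this.symm

/-! ### Euler's formula and the cycle space -/

/-- Reversal as a permutation of the directed edges of the component. -/
def revArcs (D : ComponentTree G ι) (i : ι) : Equiv.Perm (D.arcs i) :=
  Arc.rev.subtypePerm (fun a => by
    exact ⟨fun h => by simpa using rev_mem_arcs h, rev_mem_arcs⟩)

/-- The successor of a directed edge on the boundary of a face. -/
def stepArcs : Equiv.Perm (D.arcs i) :=
  (E.rot * Arc.rev).subtypePerm (fun a => by
    rw [Equiv.Perm.mul_apply, E.rot_mem_arcs_iff, rev_mem_arcs_iff])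

/-- Gradients and face differences are skew-symmetric and orthogonal. By connectedness only the
constants are lost, so together they have dimension at least vertices plus faces minus two, the
number of edges by Euler's formula. Hence they fill the skew-symmetric functions, and a
divergence-free `c` has no gradient component. -/
theorem exists_face_potential
    (hconn : ∀ u ∈ D.bag i, ∀ v ∈ D.bag i, Relation.ReflTransGen (D.Link i) u v)
    (hne : (D.arcs i).Nonempty) [Fintype (D.arcs i)] (c : Arc G → ℚ)
    (hc : ∀ a ∈ D.arcs i, c (Arc.rev a) = -c a)
    (hdiv : ∀ φ : V → ℚ, ∑ a : D.arcs i, (φ a.1.head - φ a.1.tail) * c a = 0) :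
    ∃ g : Set (Arc G) → ℚ, ∀ a ∈ D.arcs i, c a = g (E.face a) - g (E.face (Arc.rev a)) := by
  classical
  obtain ⟨a₀, ha₀⟩ := hne
  let F := D.faces i E.rot
  let _ : Fintype F := Fintype.ofFinite F
  let t : (D.bag i → ℚ) → D.arcs i → ℚ := fun φ a => φ ⟨a.1.tail, tail_mem_bag a.2⟩
  let q : (F → ℚ) → D.arcs i → ℚ := fun g a => g ⟨E.face a.1, E.face_mem_faces a.2⟩
  let rev := revArcs D i
  have hrr : ∀ a, rev (rev a) = a := fun a => Subtype.ext (Arc.rev_rev a.1)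
  have horth : ∀ φ g, ∑ a, (t φ (rev a) - t φ a) * (q g a - q g (rev a)) = 0 := by
    intro φ g
    apply sum_gradient_mul_boundary rev E.stepArcs hrr
    · intro a
      have : (E.stepArcs a).1.tail = (rev a).1.tail := (E.rot_spec (rev_mem_arcs a.2)).2
      simp only [t, this]
    · intro a
      have : E.face (E.stepArcs a).1 = E.face a.1 := E.face_rot_rev a.1
      simp only [q, this]
  let Φ : ((D.bag i → ℚ) × (F → ℚ)) →ₗ[ℚ] (D.arcs i → ℚ) :=
    { toFun := fun x a => (t x.1 (rev a) - t x.1 a) + (q x.2 a - q x.2 (rev a))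
      map_add' := fun x y => by ext a; simp [t, q]; ring
      map_smul' := fun r x => by ext a; simp [t, q]; ring }
  let S : Submodule ℚ (D.arcs i → ℚ) :=
    { carrier := {c | ∀ a, c (rev a) = -c a}
      add_mem' := fun h h' a => by simp [h a, h' a]; ring
      zero_mem' := fun a => by simp
      smul_mem' := fun r c h a => by simp [h a] }
  have hrange : LinearMap.range Φ ≤ S := by
    rintro _ ⟨x, rfl⟩ a
    change (t x.1 (rev (rev a)) - t x.1 (rev a)) + (q x.2 (rev a) - q x.2 (rev (rev a))) =
      -((t x.1 (rev a) - t x.1 a) + (q x.2 a - q x.2 (rev a)))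
    rw [hrr]; ring
  have hSdim : 2 * Module.finrank ℚ S ≤ Fintype.card (D.arcs i) := by
    let _ : LinearOrder (D.arcs i) := linearOrderOfSTO WellOrderingRel
    exact two_mul_finrank_skew_le rev hrr
      (fun a h => rev_ne a.2 (congrArg Subtype.val h)) S (fun c h => h)
  have tconst : ∀ φ, (∀ a, t φ (rev a) - t φ a = 0) → ∀ u v, φ u = φ v := by
    intro φ h
    have key : ∀ u v, Relation.ReflTransGen (D.Link i) u v → ∀ hu : u ∈ D.bag i,
        ∀ hv : v ∈ D.bag i, φ ⟨u, hu⟩ = φ ⟨v, hv⟩ := by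
      intro u v huv
      induction huv with
      | refl => intros; rfl
      | tail _ h' ih =>
        intro hu hv
        obtain ⟨a, ha, rfl, rfl⟩ := h'
        rw [ih hu (tail_mem_bag ha)]
        have := h ⟨a, ha⟩
        exact (sub_eq_zero.1 this).symm
    exact fun u v => key _ _ (hconn _ u.2 _ v.2) _ _
  have qconst : ∀ g, (∀ a, q g a - q g (rev a) = 0) → ∀ f f', g f = g f' := by
    intro g h
    have key : ∀ f, g f = q g ⟨a₀, ha₀⟩ := by
      rintro ⟨f, hf⟩
      obtain ⟨b, hb, rfl⟩ := E.exists_eq_face ⟨a₀, ha₀⟩ hf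
      obtain ⟨_, h2⟩ := E.arc_induction hconn
        (p := fun b => ∃ hb : b ∈ D.arcs i, q g ⟨b, hb⟩ = q g ⟨a₀, ha₀⟩) ha₀ hb ⟨ha₀, rfl⟩
        (by
          rintro c hc ⟨_, h1⟩
          exact ⟨rev_mem_arcs hc, h1 ▸ (sub_eq_zero.1 (h ⟨c, hc⟩)).symm⟩)
        (by
          rintro c hc ⟨_, h1⟩
          refine ⟨E.rot_mem_arcs_iff.2 hc, ?_⟩
          rw [← h1, sub_eq_zero.1 (h ⟨c, hc⟩)]
          simp only [q]
          congr 1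
          exact Subtype.ext (E.face_rot c))
      exact h2
    exact fun f f' => (key f).trans (key f').symm
  -- If a gradient and a face difference add up to zero, the gradient is orthogonal to itself.
  have split0 : ∀ φ g, (∀ a, (t φ (rev a) - t φ a) + (q g a - q g (rev a)) = 0) →
      (∀ a, t φ (rev a) - t φ a = 0) ∧ ∀ a, q g a - q g (rev a) = 0 := by
    intro φ g h
    have h0 : ∑ a, (t φ (rev a) - t φ a) * (t φ (rev a) - t φ a) = 0 := by
      have e : ∀ a, (t φ (rev a) - t φ a) * (t φ (rev a) - t φ a) =
          -((t φ (rev a) - t φ a) * (q g a - q g (rev a))) := by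
        intro a
        have := h a
        rw [eq_neg_of_add_eq_zero_left this]; ring
      rw [Finset.sum_congr rfl (fun a _ => e a), Finset.sum_neg_distrib, horth, neg_zero]
    rw [Finset.sum_eq_zero_iff_of_nonneg (fun a _ => mul_self_nonneg _)] at h0
    have h1 : ∀ a, t φ (rev a) - t φ a = 0 := fun a => mul_self_eq_zero.1 (h0 a (by simp))
    exact ⟨h1, fun a => by have := h a; rw [h1 a, zero_add] at this; exact this⟩
  -- A kernel element is a constant on the vertices and a constant on the faces, so it is determined
  -- by its values at one vertex and one face.
  have hker : Module.finrank ℚ (LinearMap.ker Φ) ≤ 2 := by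
    let L : LinearMap.ker Φ →ₗ[ℚ] ℚ × ℚ :=
      { toFun := fun x => (x.1.1 ⟨a₀.tail, tail_mem_bag ha₀⟩,
          x.1.2 ⟨E.face a₀, E.face_mem_faces ha₀⟩)
        map_add' := fun x y => by simp
        map_smul' := fun r x => by simp }
    have hL : Function.Injective L := by
      rw [← LinearMap.ker_eq_bot, LinearMap.ker_eq_bot']
      rintro ⟨⟨φ, g⟩, hx⟩ h
      have hx' : ∀ a, (t φ (rev a) - t φ a) + (q g a - q g (rev a)) = 0 :=
        fun a => congrFun (LinearMap.mem_ker.1 hx) a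
      obtain ⟨h1, h2⟩ := split0 φ g hx'
      have h3 : φ ⟨a₀.tail, tail_mem_bag ha₀⟩ = 0 := congrArg Prod.fst h
      have h4 : g ⟨E.face a₀, E.face_mem_faces ha₀⟩ = 0 := congrArg Prod.snd h
      apply Subtype.ext
      apply Prod.ext
      · funext u; exact (tconst φ h1 u _).trans h3
      · funext f; exact (qconst g h2 f _).trans h4
    have := LinearMap.finrank_le_finrank_of_injective hL
    simpa using this
  have hdim := LinearMap.finrank_range_add_finrank_ker Φ
  rw [Module.finrank_prod, Module.finrank_pi, Module.finrank_pi] at hdim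
  have heul := E.euler
  have hF : (D.faces i E.rot).ncard = Fintype.card F := by
    rw [← Nat.card_coe_set_eq, Nat.card_eq_fintype_card]
  have hA : (D.arcs i).ncard = Fintype.card (D.arcs i) := by
    rw [← Nat.card_coe_set_eq, Nat.card_eq_fintype_card]
  rw [hF, hA] at heul
  rw [Fintype.card_coe] at hdim
  have hSeq : LinearMap.range Φ = S := Submodule.eq_of_le_of_finrank_le hrange (by omega)
  have hcS : (fun a : D.arcs i => c a) ∈ S := fun a => hc a.1 a.2
  rw [← hSeq] at hcS
  obtain ⟨⟨φ, g⟩, hx⟩ := hcS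
  have hx' : ∀ a : D.arcs i, (t φ (rev a) - t φ a) + (q g a - q g (rev a)) = c a :=
    fun a => congrFun hx a
  have hφ : ∀ a, t φ (rev a) - t φ a = 0 := by
    let ψ : V → ℚ := fun v => if h : v ∈ D.bag i then φ ⟨v, h⟩ else 0
    have hψ : ∀ a : D.arcs i, ψ a.1.head - ψ a.1.tail = t φ (rev a) - t φ a := by
      intro a
      have h1 : a.1.head ∈ D.bag i := head_mem_bag a.2
      have h2 : a.1.tail ∈ D.bag i := tail_mem_bag a.2
      simp only [ψ, h1, h2, dif_pos]
      rfl
    have h0 : ∑ a, (t φ (rev a) - t φ a) * (t φ (rev a) - t φ a) = 0 := by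
      have e : ∀ a, (t φ (rev a) - t φ a) * (t φ (rev a) - t φ a) =
          (ψ a.1.head - ψ a.1.tail) * c a.1 -
            (t φ (rev a) - t φ a) * (q g a - q g (rev a)) := by
        intro a
        rw [hψ, ← hx' a]; ring
      rw [Finset.sum_congr rfl (fun a _ => e a), Finset.sum_sub_distrib, hdiv, horth, sub_zero]
    rw [Finset.sum_eq_zero_iff_of_nonneg (fun a _ => mul_self_nonneg _)] at h0
    exact fun a => mul_self_eq_zero.1 (h0 a (by simp))
  refine ⟨fun f => if h : f ∈ F then g ⟨f, h⟩ else 0, fun a ha => ?_⟩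
  have h1 : E.face a ∈ F := E.face_mem_faces ha
  have h2 : E.face (Arc.rev a) ∈ F := E.face_mem_faces (rev_mem_arcs ha)
  have := hx' ⟨a, ha⟩
  rw [hφ, zero_add] at this
  simp only [h1, h2, dif_pos]
  exact this.symm

end ComponentTree.PlaneEmbedding

/-! ### Simple cycles in a component and their interiors -/

namespace ComponentTree

variable {V ι : Type*} {G : SimpleGraph V} {D : ComponentTree G ι} {i : ι}

/-- The set `Q` of directed edges of the component `i` forms a directed simple cycle. -/
structure IsArcCycle (D : ComponentTree G ι) (i : ι) (Q : Set (Arc G)) : Prop where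
  subset : Q ⊆ D.arcs i
  nonempty : Q.Nonempty
  tail_inj : Set.InjOn Arc.tail Q
  head_inj : Set.InjOn Arc.head Q
  image_eq : Arc.tail '' Q = Arc.head '' Q
  rev_notMem : ∀ a ∈ Q, Arc.rev a ∉ Q
  connected : ∀ a ∈ Q, ∀ b ∈ Q,
    Relation.ReflTransGen (fun a b => a ∈ Q ∧ b ∈ Q ∧ a.head = b.tail) a b

-- Each vertex of the cycle is the head of one of its directed edges and the tail of one, so the
-- potential differences telescope. Reversal reduces the second indicator to the first.
open scoped Classical in
theorem IsArcCycle.sum_gradient [Fintype (D.arcs i)] {Q : Set (Arc G)} (hQ : D.IsArcCycle i Q)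
    (φ : V → ℚ) :
    ∑ a : D.arcs i, (φ a.1.head - φ a.1.tail) *
      ((if a.1 ∈ Q then 1 else 0) - (if Arc.rev a.1 ∈ Q then 1 else 0)) = 0 := by
  have hQfin : Q.Finite := (Set.toFinite (D.arcs i)).subset hQ.subset
  have e1 : ∑ a : D.arcs i, (φ a.1.head - φ a.1.tail) * (if a.1 ∈ Q then 1 else 0) = 0 := by
    have : ∑ a : D.arcs i, (φ a.1.head - φ a.1.tail) * (if a.1 ∈ Q then 1 else 0) =
        ∑ a ∈ hQfin.toFinset, (φ a.head - φ a.tail) := by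
      simp only [mul_ite, mul_one, mul_zero]
      rw [← Finset.sum_filter]
      refine Finset.sum_bij (fun a _ => a.1) ?_ ?_ ?_ ?_
      · intro a ha; simpa using ha
      · intro a _ b _ h; exact Subtype.ext h
      · intro b hb
        rw [Set.Finite.mem_toFinset] at hb
        exact ⟨⟨b, hQ.subset hb⟩, by simpa using hb, rfl⟩
      · intros; rfl
    rw [this, Finset.sum_sub_distrib]
    have h1 : ∑ a ∈ hQfin.toFinset, φ a.head = ∑ v ∈ hQfin.toFinset.image Arc.head, φ v := by
      rw [Finset.sum_image]
      intro a ha b hb h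
      exact hQ.head_inj (by simpa using ha) (by simpa using hb) h
    have h2 : ∑ a ∈ hQfin.toFinset, φ a.tail = ∑ v ∈ hQfin.toFinset.image Arc.tail, φ v := by
      rw [Finset.sum_image]
      intro a ha b hb h
      exact hQ.tail_inj (by simpa using ha) (by simpa using hb) h
    have h3 : hQfin.toFinset.image Arc.head = hQfin.toFinset.image Arc.tail := by
      apply Finset.coe_injective
      simpa using hQ.image_eq.symm
    rw [h1, h2, h3, sub_self]
  have e2 : ∑ a : D.arcs i, (φ a.1.head - φ a.1.tail) * (if Arc.rev a.1 ∈ Q then 1 else 0) =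
      0 := by
    rw [← Equiv.sum_comp (PlaneEmbedding.revArcs D i)]
    have : ∀ a : D.arcs i, (φ (PlaneEmbedding.revArcs D i a).1.head -
        φ (PlaneEmbedding.revArcs D i a).1.tail) *
          (if Arc.rev (PlaneEmbedding.revArcs D i a).1 ∈ Q then 1 else 0) =
        -((φ a.1.head - φ a.1.tail) * (if a.1 ∈ Q then 1 else 0)) := by
      intro a
      have : (PlaneEmbedding.revArcs D i a).1 = Arc.rev a.1 := rfl
      rw [this, Arc.rev_rev, Arc.head_rev, Arc.tail_rev]; ring
    rw [Finset.sum_congr rfl (fun a _ => this a), Finset.sum_neg_distrib, e1, neg_zero]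
  simp only [mul_sub, Finset.sum_sub_distrib]
  rw [e1, e2, sub_zero]

namespace PlaneEmbedding

variable [Finite V] (E : D.PlaneEmbedding i)

open scoped Classical in
/-- A directed simple cycle is, up to the sign, the boundary of the set of the faces inside. -/
theorem exists_interior
    (hconn : ∀ u ∈ D.bag i, ∀ v ∈ D.bag i, Relation.ReflTransGen (D.Link i) u v)
    {Q : Set (Arc G)} (hQ : D.IsArcCycle i Q) :
    ∃ (I : Set (Set (Arc G))) (s : ℤ), (s = 1 ∨ s = -1) ∧ (∀ f ∈ I, E.IsInnerFace f) ∧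
      ∀ a ∈ D.arcs i, ((if a ∈ Q then 1 else 0) - (if Arc.rev a ∈ Q then 1 else 0) : ℤ) =
        s * ((if E.face a ∈ I then 1 else 0) - (if E.face (Arc.rev a) ∈ I then 1 else 0)) := by
  obtain ⟨a₀, ha₀⟩ := hQ.nonempty
  have ha₀' := hQ.subset ha₀
  let _ : Fintype (D.arcs i) := Fintype.ofFinite _
  -- `g` acts as a winding number: it is larger by one on the right of the cycle than on its left
  -- and changes nowhere else.
  obtain ⟨g, hg⟩ := E.exists_face_potential hconn ⟨a₀, ha₀'⟩
    (fun a => (if a ∈ Q then 1 else 0) - (if Arc.rev a ∈ Q then 1 else 0))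
    (fun a _ => by simp) hQ.sum_gradient
  have hg0 : ∀ a ∈ D.arcs i, a ∉ Q → Arc.rev a ∉ Q → g (E.face a) = g (E.face (Arc.rev a)) := by
    intro a ha h1 h2
    have := hg a ha
    simp only [h1, h2, if_false, sub_self] at this
    linarith
  have hg1 : ∀ a ∈ Q, g (E.face (Arc.rev a)) = g (E.face a) - 1 := by
    intro a ha
    have := hg a (hQ.subset ha)
    simp only [ha, hQ.rev_notMem a ha, if_true, if_false] at this
    linarith
  -- Turning from `a` to its successor `b` on the right-hand side meets no other edge of the simple
  -- cycle.
  have hstep : ∀ a ∈ Q, ∀ b ∈ Q, a.head = b.tail → g (E.face a) = g (E.face b) := by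
    intro a ha b hb hab
    refine E.rotation_const g (hQ.subset ha) (hQ.subset hb) hab ?_
    intro e he het hne hne'
    refine hg0 e he (fun h => hne (hQ.tail_inj h hb het)) (fun h => hne' ?_)
    have := hQ.head_inj h ha (by simp [het, hab])
    rw [← this, Arc.rev_rev]
  have hQconst : ∀ b ∈ Q, g (E.face b) = g (E.face a₀) := by
    intro b hb
    have := hQ.connected a₀ ha₀ b hb
    induction this with
    | refl => rfl
    | tail _ h ih => rw [← hstep _ h.1 _ h.2.1 h.2.2, ih h.1]
  set p := g (E.face a₀) with hp
  have hval : ∀ b ∈ D.arcs i, g (E.face b) = p ∨ g (E.face b) = p - 1 := by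
    have hrev : ∀ c ∈ D.arcs i, (g (E.face c) = p ∨ g (E.face c) = p - 1) →
        (g (E.face (Arc.rev c)) = p ∨ g (E.face (Arc.rev c)) = p - 1) := by
      intro c hc h
      by_cases h1 : c ∈ Q
      · rw [hg1 c h1, hQconst c h1]; exact Or.inr rfl
      · by_cases h2 : Arc.rev c ∈ Q
        · exact Or.inl (hQconst _ h2)
        · rwa [← hg0 c hc h1 h2]
    intro b hb
    refine E.arc_induction hconn (p := fun b => g (E.face b) = p ∨ g (E.face b) = p - 1)
      ha₀' hb (Or.inl rfl) hrev ?_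
    intro c hc h
    rw [E.face_rot]
    exact hrev c hc h
  obtain ⟨o, ho, hout⟩ := E.exists_eq_face ⟨a₀, ha₀'⟩ E.outer_mem
  -- Inside means that `g` differs from its value on the outer face; the sign `s` records on which
  -- side of the cycle the outer face lies.
  obtain ⟨I, hIdef⟩ : ∃ I : Set (Set (Arc G)), ∀ f, f ∈ I ↔
      f ∈ D.faces i E.rot ∧ g f ≠ g E.outer := ⟨{f | _}, fun _ => Iff.rfl⟩
  have hI : ∀ f ∈ I, E.IsInnerFace f := fun f hf =>
    ⟨((hIdef f).1 hf).1, fun h => ((hIdef f).1 hf).2 (by rw [h])⟩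
  have hmemI : ∀ a ∈ D.arcs i, E.face a ∈ I ↔ g (E.face a) ≠ g E.outer :=
    fun a ha => ⟨fun h => ((hIdef _).1 h).2, fun h => (hIdef _).2 ⟨E.face_mem_faces ha, h⟩⟩
  have hind : ∃ s : ℤ, (s = 1 ∨ s = -1) ∧ ∀ a ∈ D.arcs i,
      g (E.face a) - g E.outer = s * (if E.face a ∈ I then 1 else 0) := by
    rcases hval o ho with h | h <;> rw [← hout] at h
    · refine ⟨-1, Or.inr rfl, fun a ha => ?_⟩
      rw [hmemI a ha, h]
      rcases hval a ha with h' | h' <;> simp [h']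
    · refine ⟨1, Or.inl rfl, fun a ha => ?_⟩
      have hne : p ≠ p - 1 := fun h => by linarith
      rw [hmemI a ha, h]
      rcases hval a ha with h' | h' <;> simp [h', hne]
  obtain ⟨s, hs, hsI⟩ := hind
  refine ⟨I, s, hs, hI, fun a ha => ?_⟩
  have h1 := hg a ha
  have h2 := hsI a ha
  have h3 := hsI _ (rev_mem_arcs ha)
  have : (((if a ∈ Q then 1 else 0) - (if Arc.rev a ∈ Q then 1 else 0) : ℤ) : ℚ) =
      ((s * ((if E.face a ∈ I then 1 else 0) -
        (if E.face (Arc.rev a) ∈ I then 1 else 0)) : ℤ) : ℚ) := by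
    push_cast
    rw [mul_sub, ← h2, ← h3]
    linarith
  exact_mod_cast this

open scoped Classical in
/-- The weight of a simple cycle is, up to the sign, the sum of the circulations of the faces
inside. -/
theorem sum_weight_eq {Q : Set (Arc G)} (hQ : D.IsArcCycle i Q) {I : Set (Set (Arc G))} {s : ℤ}
    (hI : ∀ f ∈ I, E.IsInnerFace f)
    (h : ∀ a ∈ D.arcs i, ((if a ∈ Q then 1 else 0) - (if Arc.rev a ∈ Q then 1 else 0) : ℤ) =
        s * ((if E.face a ∈ I then 1 else 0) - (if E.face (Arc.rev a) ∈ I then 1 else 0)))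
    {w : EdgeWeight G} (hw : w.SkewSymmetric) :
    ∑ᶠ a ∈ Q, Arc.weight w a = s * ∑ᶠ f ∈ I, faceCirculation w f := by
  let _ : Fintype (D.arcs i) := Fintype.ofFinite _
  let _ : Fintype (Arc G) := Fintype.ofFinite _
  let _ : Fintype (Set (Arc G)) := Fintype.ofFinite _
  -- antisymmetrization of a sum over the directed edges
  have anti : ∀ x : Arc G → ℤ,
      ∑ a : D.arcs i, (x a - x (Arc.rev a)) * Arc.weight w a =
        2 * ∑ a : D.arcs i, x a * Arc.weight w a := by
    intro x
    have : ∑ a : D.arcs i, x (Arc.rev a.1) * Arc.weight w a =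
        -∑ a : D.arcs i, x a * Arc.weight w a := by
      rw [← Equiv.sum_comp (revArcs D i), ← Finset.sum_neg_distrib]
      refine Finset.sum_congr rfl (fun a _ => ?_)
      have : (revArcs D i a).1 = Arc.rev a.1 := rfl
      rw [this, Arc.rev_rev, Arc.weight_rev hw]; ring
    simp only [sub_mul, Finset.sum_sub_distrib]
    rw [this]; ring
  have e1 : ∑ᶠ a ∈ Q, Arc.weight w a =
      ∑ a : D.arcs i, (if a.1 ∈ Q then 1 else 0) * Arc.weight w a := by
    rw [finsum_mem_eq_finite_toFinset_sum _ (Set.toFinite Q)]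
    simp only [ite_mul, one_mul, zero_mul]
    rw [← Finset.sum_filter]
    symm
    refine Finset.sum_bij (fun a _ => a.1) ?_ ?_ ?_ ?_
    · intro a ha; simpa using ha
    · intro a _ b _ h; exact Subtype.ext h
    · intro b hb
      rw [Set.Finite.mem_toFinset] at hb
      exact ⟨⟨b, hQ.subset hb⟩, by simpa using hb, rfl⟩
    · intros; rfl
  have e2 : ∑ᶠ f ∈ I, faceCirculation w f =
      ∑ a : D.arcs i, (if E.face a ∈ I then 1 else 0) * Arc.weight w a := by
    rw [finsum_mem_eq_finite_toFinset_sum _ (Set.toFinite I)]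
    have : ∀ f ∈ (Set.toFinite I).toFinset, faceCirculation w f =
        ∑ a : D.arcs i, (if E.face a = f then Arc.weight w a else 0) := by
      intro f hf
      have hf' : f ∈ D.faces i E.rot := (hI f (by simpa using hf)).1
      rw [faceCirculation, finsum_mem_eq_finite_toFinset_sum _ (Set.toFinite f),
        ← Finset.sum_filter]
      symm
      refine Finset.sum_bij (fun a _ => a.1) ?_ ?_ ?_ ?_
      · intro a ha
        simp only [Finset.mem_filter, Finset.mem_univ, true_and] at ha
        simpa [← ha] using E.mem_face a.1
      · intro a _ b _ h; exact Subtype.ext h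
      · intro b hb
        rw [Set.Finite.mem_toFinset] at hb
        have := E.eq_face_of_mem hf' hb
        exact ⟨⟨b, this.1⟩, by simpa using this.2.symm, rfl⟩
      · intros; rfl
    rw [Finset.sum_congr rfl this, Finset.sum_comm]
    refine Finset.sum_congr rfl (fun a _ => ?_)
    rw [Finset.sum_ite_eq]
    simp
  have e3 := anti (fun a => if a ∈ Q then 1 else 0)
  have e4 := anti (fun a => if E.face a ∈ I then 1 else 0)
  have e5 : ∑ a : D.arcs i, ((if a.1 ∈ Q then 1 else 0) - (if Arc.rev a.1 ∈ Q then 1 else 0)) *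
      Arc.weight w a = s * ∑ a : D.arcs i, ((if E.face a.1 ∈ I then 1 else 0) -
        (if E.face (Arc.rev a.1) ∈ I then 1 else 0)) * Arc.weight w a := by
    rw [Finset.mul_sum]
    refine Finset.sum_congr rfl (fun a _ => ?_)
    rw [h a.1 a.2]; ring
  rw [e3, e4] at e5
  rw [e1, e2]
  linarith

end PlaneEmbedding

end ComponentTree

/-! ### Cycles, indexed cyclically -/

/-- A cycle of `G`, given by its directed edges in cyclic order. -/
structure IsDartCycle {V : Type*} {G : SimpleGraph V} {n : ℕ} (d : ZMod n → G.Dart) : Prop where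
  three_le : 3 ≤ n
  next : ∀ k, (d (k + 1)).fst = (d k).snd
  inj : ∀ k j, (d k).fst = (d j).fst → k = j

/-- Indices modulo the length remove the special role of the base vertex, so that gaps may run past
it. -/
theorem SimpleGraph.Walk.IsCycle.exists_isDartCycle {V : Type*} {G : SimpleGraph V} {v : V}
    {C : G.Walk v v} (hC : C.IsCycle) : ∃ (n : ℕ) (_ : NeZero n) (d : ZMod n → G.Dart),
      IsDartCycle d ∧ ∀ w : EdgeWeight G, w.circulation C = ∑ k, w (d k) := by
  have h3 := hC.three_le_length
  have hlen : C.darts.length = C.length := C.length_darts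
  have hn : NeZero C.length := ⟨by omega⟩
  have hlt : ∀ k : ZMod C.length, k.val < C.darts.length := fun k => by
    rw [hlen]; exact ZMod.val_lt k
  have hfst : ∀ k : ZMod C.length, (C.darts[k.val]'(hlt k)).fst = C.getVert k.val := by
    intro k; simp [SimpleGraph.Walk.support_getElem_eq_getVert]
  have hsnd : ∀ k : ZMod C.length, (C.darts[k.val]'(hlt k)).snd = C.getVert (k.val + 1) := by
    intro k; simp [SimpleGraph.Walk.support_getElem_eq_getVert]
  refine ⟨C.length, hn, fun k => C.darts[k.val]'(hlt k), ⟨h3, ?_, ?_⟩, ?_⟩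
  · intro k
    rw [hfst, hsnd]
    have hk := ZMod.val_lt k
    have h1 : (1 : ZMod C.length).val = 1 := by
      rw [ZMod.val_one_eq_one_mod]; exact Nat.mod_eq_of_lt (by omega)
    rw [ZMod.val_add, h1]
    by_cases h : k.val + 1 = C.length
    · rw [h, Nat.mod_self]; simp
    · rw [Nat.mod_eq_of_lt (by omega)]
  · intro k j h
    rw [hfst, hfst] at h
    have hk := ZMod.val_lt k
    have hj := ZMod.val_lt j
    exact ZMod.val_injective _ (hC.getVert_injOn' (by simp; omega) (by simp; omega) h)
  · intro w
    rw [EdgeWeight.circulation]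
    rw [← Fin.sum_univ_fun_getElem]
    symm
    refine Finset.sum_bij (fun k _ => (⟨k.val, hlt k⟩ : Fin C.darts.length)) ?_ ?_ ?_ ?_
    · simp
    · intro a _ b _ h
      exact ZMod.val_injective _ (congrArg Fin.val h)
    · intro b _
      refine ⟨(b.1 : ZMod C.length), by simp, ?_⟩
      apply Fin.ext
      simp only [ZMod.val_natCast]
      exact Nat.mod_eq_of_lt (hlen ▸ b.2)
    · intros; rfl

/-- Going around the cycle, `k` and `k + r` are the ends of a gap of the set `p`. -/
def IsGap {n : ℕ} (p : ZMod n → Prop) (k : ZMod n) (r : ℕ) : Prop :=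
  p k ∧ p (k + r) ∧ 2 ≤ r ∧ r ≤ n ∧ ∀ s : ℕ, 0 < s → s < r → ¬ p (k + s)

namespace IsGap

variable {n : ℕ} {p : ZMod n → Prop} {k k' : ZMod n} {r r' : ℕ}

theorem eq_of_left (h : IsGap p k r) (h' : IsGap p k r') : r = r' := by
  obtain ⟨-, h2, h3, -, h4⟩ := h
  obtain ⟨-, h2', h3', -, h4'⟩ := h'
  rcases lt_trichotomy r r' with hr | hr | hr
  · exact (h4' r (by omega) hr h2).elim
  · exact hr
  · exact (h4 r' (by omega) hr h2').elim

/-- If the second gap were longer, the left end `k` of the first one would lie strictly inside it.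
-/
theorem le_of_right (h : IsGap p k r) (h' : IsGap p k' r') (e : k + r = k' + r') : r' ≤ r := by
  by_contra hr
  push Not at hr
  apply h'.2.2.2.2 (r' - r) (by omega) (by have := h.2.2.1; omega)
  rw [Nat.cast_sub hr.le]
  have : k' + (r' - r : ZMod n) = k := by linear_combination -e
  rw [this]; exact h.1

theorem eq_of_right (h : IsGap p k r) (h' : IsGap p k' r') (e : k + r = k' + r') : k = k' := by
  have : r = r' := le_antisymm (le_of_right h' h e.symm) (le_of_right h h' e)
  subst this
  exact add_right_cancel e

theorem not_succ (h : IsGap p k r) : ¬ p (k + 1) := by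
  have := h.2.2.2.2 1 one_pos (by have := h.2.2.1; omega)
  simpa using this

theorem not_pred (h : IsGap p k r) : ¬ p (k + r - 1) := by
  have h2 := h.2.2.1
  have := h.2.2.2.2 (r - 1) (by omega) (by omega)
  rw [Nat.cast_sub (by omega)] at this
  simpa [add_sub_assoc] using this

theorem exists_right [NeZero n] (hk : p k) (h : ¬ p (k + 1)) : ∃ r, IsGap p k r := by
  classical
  have hex : ∃ r : ℕ, 0 < r ∧ p (k + r) := ⟨n, NeZero.pos n, by simpa using hk⟩
  refine ⟨Nat.find hex, hk, (Nat.find_spec hex).2, ?_, ?_, ?_⟩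
  · have h0 := (Nat.find_spec hex).1
    by_contra h2
    have h1 : Nat.find hex = 1 := by omega
    have := (Nat.find_spec hex).2
    rw [h1] at this
    exact h (by simpa using this)
  · exact Nat.find_min' hex ⟨NeZero.pos n, by simpa using hk⟩
  · intro s hs hs' h'
    exact Nat.find_min hex hs' ⟨hs, h'⟩

/-- Every element outside the set `p` lies in a gap. -/
theorem exists_around [NeZero n] {k₀ : ZMod n} (h₀ : p k₀) (hk : ¬ p k) :
    ∃ k₁ r, IsGap p k₁ r ∧ ∃ s : ℕ, 0 < s ∧ s < r ∧ k = k₁ + s := by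
  classical
  have hex : ∃ s : ℕ, p (k - s) := ⟨(k - k₀).val, by simpa using h₀⟩
  set s := Nat.find hex with hs
  have hps : p (k - s) := Nat.find_spec hex
  have hmin : ∀ t < s, ¬ p (k - t) := fun t ht => Nat.find_min hex ht
  have hs0 : 0 < s := by
    rcases Nat.eq_zero_or_pos s with h | h
    · rw [h] at hps; exact (hk (by simpa using hps)).elim
    · exact h
  have hno : ∀ t : ℕ, 0 < t → t ≤ s → ¬ p (k - s + t) := by
    intro t ht hts
    have := hmin (s - t) (by omega)
    rw [Nat.cast_sub hts] at this
    have e : k - ((s : ZMod n) - t) = k - s + t := by ring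
    rwa [e] at this
  obtain ⟨r, hr⟩ := exists_right (k := k - (s : ZMod n)) hps (by simpa using hno 1 one_pos hs0)
  refine ⟨k - s, r, hr, s, hs0, ?_, by ring⟩
  by_contra h
  exact hno r (by have := hr.2.2.1; omega) (by omega) hr.2.1

theorem exists_left [NeZero n] (hk : p k) (h : ¬ p (k - 1)) :
    ∃ k' r, IsGap p k' r ∧ k' + r = k := by
  obtain ⟨k₁, r, hr, s, hs, hsr, e⟩ := exists_around hk h
  refine ⟨k₁, r, hr, ?_⟩
  have e' : k = k₁ + (s + 1 : ℕ) := by push_cast; linear_combination e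
  by_cases h1 : s + 1 < r
  · exact (hr.2.2.2.2 (s + 1) (by omega) h1 (e' ▸ hk)).elim
  · have : r = s + 1 := by omega
    rw [this, e']

end IsGap

/-! ### Closing the trace of a cycle on a component by virtual edges -/

namespace IsDartCycle

variable {V ι : Type*} {G : SimpleGraph V} {n : ℕ} {d : ZMod n → G.Dart}

theorem eq_succ (hd : IsDartCycle d) {k j : ZMod n} (h : (d k).fst = (d j).snd) : k = j + 1 :=
  hd.inj _ _ (by rw [h, hd.next])

theorem eq_of_snd (hd : IsDartCycle d) {k j : ZMod n} (h : (d k).snd = (d j).snd) : k = j := by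
  rw [← hd.next] at h
  exact add_right_cancel (hd.eq_succ h)

theorem injective (hd : IsDartCycle d) : Function.Injective d :=
  fun k j h => hd.inj k j (by rw [h])

theorem ne_symm (hd : IsDartCycle d) (k j : ZMod n) : d k ≠ (d j).symm := by
  intro h
  have h1 : k = j + 1 := hd.eq_succ (by rw [h]; rfl)
  have h2 : j = k + 1 := hd.eq_succ (by rw [h]; rfl)
  have h3 : ((2 : ℕ) : ZMod n) = 0 := by push_cast; linear_combination -h1 - h2
  rw [ZMod.natCast_eq_zero_iff] at h3
  have := hd.three_le
  exact absurd (Nat.le_of_dvd two_pos h3) (by omega)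

theorem edge_injective (hd : IsDartCycle d) : Function.Injective fun k => (d k).edge := by
  intro k j h
  rcases SimpleGraph.dart_edge_eq_iff _ _ |>.1 h with h | h
  · exact hd.injective h
  · exact (hd.ne_symm k j h).elim

/-- The set `Q` of the directed edges of a cycle with index in `p`, closed by virtual edges. -/
def closing (d : ZMod n → G.Dart) (p : ZMod n → Prop) : Set (Arc G) :=
  {a | (∃ k, p k ∧ a = Sum.inl (d k)) ∨
    ∃ k r, IsGap p k r ∧ a = Sum.inr ((d k).snd, (d (k + r)).fst)}

variable {D : ComponentTree G ι} {i : ι} {p : ZMod n → Prop}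

theorem inl_mem_closing {k : ZMod n} (h : p k) : (Sum.inl (d k) : Arc G) ∈ closing d p :=
  Or.inl ⟨k, h, rfl⟩

theorem inr_mem_closing {k : ZMod n} {r : ℕ} (h : IsGap p k r) :
    (Sum.inr ((d k).snd, (d (k + r)).fst) : Arc G) ∈ closing d p :=
  Or.inr ⟨k, r, h, rfl⟩

/-- Each virtual edge leads from where the cycle leaves `p` to where it enters `p` again, so heads
and tails match, and injectivity is inherited from the cycle. If `p` holds at one index only, the
gap has `r = n` and the result consists of a real edge and a virtual edge back; this is a legitimate
cycle because the component is a multigraph. -/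
theorem isArcCycle_closing [NeZero n] (hd : IsDartCycle d)
    (hp : ∀ k, p k → D.home (d k).edge = i)
    (hgap : ∀ k r, IsGap p k r →
      (Sum.inr ((d k).snd, (d (k + r)).fst) : Arc G) ∈ D.arcs i)
    {k₀ : ZMod n} (h₀ : p k₀) : D.IsArcCycle i (closing d p) where
  subset := by
    rintro _ (⟨k, hk, rfl⟩ | ⟨k, r, h, rfl⟩)
    · exact ComponentTree.inl_mem_arcs.2 (hp k hk)
    · exact hgap k r h
  nonempty := ⟨_, inl_mem_closing h₀⟩
  tail_inj := by
    rintro _ (⟨k, hk, rfl⟩ | ⟨k, r, h, rfl⟩) _ (⟨k', hk', rfl⟩ | ⟨k', r', h', rfl⟩) e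
    · rw [hd.inj k k' e]
    · exact (h'.not_succ (hd.eq_succ (j := k') e ▸ hk)).elim
    · exact (h.not_succ (hd.eq_succ (j := k) e.symm ▸ hk')).elim
    · obtain rfl := hd.eq_of_snd e
      rw [h.eq_of_left h']
  head_inj := by
    rintro _ (⟨k, hk, rfl⟩ | ⟨k, r, h, rfl⟩) _ (⟨k', hk', rfl⟩ | ⟨k', r', h', rfl⟩) e
    · rw [hd.eq_of_snd e]
    · refine (h'.not_pred ?_).elim
      rwa [hd.eq_succ (j := k) e.symm, add_sub_cancel_right]
    · refine (h.not_pred ?_).elim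
      rwa [hd.eq_succ (j := k') e, add_sub_cancel_right]
    · have e' := hd.inj _ _ e
      obtain rfl := h.eq_of_right h' e'
      rw [h.eq_of_left h']
  image_eq := by
    apply Set.Subset.antisymm
    · rintro _ ⟨_, ⟨k, hk, rfl⟩ | ⟨k, r, h, rfl⟩, rfl⟩
      · by_cases h : p (k - 1)
        · exact ⟨_, inl_mem_closing h, by simp [← hd.next]⟩
        · obtain ⟨k', r, hr, rfl⟩ := IsGap.exists_left hk h
          exact ⟨_, inr_mem_closing hr, rfl⟩
      · exact ⟨_, inl_mem_closing h.1, rfl⟩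
    · rintro _ ⟨_, ⟨k, hk, rfl⟩ | ⟨k, r, h, rfl⟩, rfl⟩
      · by_cases h : p (k + 1)
        · exact ⟨_, inl_mem_closing h, by simp [hd.next]⟩
        · obtain ⟨r, hr⟩ := IsGap.exists_right hk h
          exact ⟨_, inr_mem_closing hr, rfl⟩
      · exact ⟨_, inl_mem_closing h.2.1, rfl⟩
  rev_notMem := by
    rintro _ (⟨k, hk, rfl⟩ | ⟨k, r, h, rfl⟩) (⟨k', hk', e⟩ | ⟨k', r', h', e⟩)
    · exact hd.ne_symm k' k (Sum.inl_injective e).symm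
    · cases e
    · cases e
    · have e' : (d (k + r)).fst = (d k').snd := (Prod.ext_iff.1 (Sum.inr_injective e)).1
      exact h'.not_succ (hd.eq_succ e' ▸ h.2.1)
  connected := by
    set r := fun a b : Arc G => a ∈ closing d p ∧ b ∈ closing d p ∧ a.head = b.tail
    have hin : ∀ k r', IsGap p k r' →
        r (Sum.inl (d k)) (Sum.inr ((d k).snd, (d (k + r')).fst)) := fun k r' h =>
      ⟨inl_mem_closing h.1, inr_mem_closing h, rfl⟩
    have hout : ∀ k r', IsGap p k r' →
        r (Sum.inr ((d k).snd, (d (k + r')).fst)) (Sum.inl (d (k + r'))) := fun k r' h =>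
      ⟨inr_mem_closing h, inl_mem_closing h.2.1, rfl⟩
    -- Strong induction on the distance ahead: either the next index is in `p`, or a whole gap is
    -- jumped.
    have key : ∀ m : ℕ, ∀ k, p k → p (k + m) →
        Relation.ReflTransGen r (Sum.inl (d k)) (Sum.inl (d (k + m))) := by
      intro m
      induction m using Nat.strong_induction_on with
      | _ m ih =>
        intro k hk hkm
        rcases Nat.eq_zero_or_pos m with rfl | hm
        · simpa using Relation.ReflTransGen.refl
        by_cases h1 : p (k + 1)
        · have e : k + (m : ZMod n) = (k + 1) + (m - 1 : ℕ) := by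
            rw [Nat.cast_sub hm]; push_cast; ring
          rw [e] at hkm ⊢
          exact (ih (m - 1) (by omega) _ h1 hkm).head
            ⟨inl_mem_closing hk, inl_mem_closing h1, by simp [hd.next]⟩
        · obtain ⟨r', hr⟩ := IsGap.exists_right hk h1
          have hrm : r' ≤ m := by
            by_contra hlt
            exact hr.2.2.2.2 m hm (by omega) hkm
          have e : k + (m : ZMod n) = (k + r') + (m - r' : ℕ) := by
            rw [Nat.cast_sub hrm]; ring
          rw [e] at hkm ⊢
          exact ((ih (m - r') (by have := hr.2.2.1; omega) _ hr.2.1 hkm).head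
            (hout k r' hr)).head (hin k r' hr)
    have key' : ∀ k j, p k → p j → Relation.ReflTransGen r (Sum.inl (d k)) (Sum.inl (d j)) := by
      intro k j hk hj
      have e : k + ((j - k).val : ZMod n) = j := by simp
      have := key (j - k).val k hk (by rwa [e])
      rwa [e] at this
    rintro _ (⟨k, hk, rfl⟩ | ⟨k, r', h, rfl⟩) _ (⟨j, hj, rfl⟩ | ⟨j, s, h', rfl⟩)
    · exact key' k j hk hj
    · exact (key' k j hk h'.1).tail (hin j s h')
    · exact (key' _ j h.2.1 hj).head (hout k r' h)
    · exact ((key' _ j h.2.1 h'.1).tail (hin j s h')).head (hout k r' h)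

/-- Virtual edges have weight zero, so closing the gaps costs nothing. -/
theorem finsum_closing [NeZero n] (hd : IsDartCycle d) (w : EdgeWeight G) [DecidablePred p] :
    ∑ᶠ a ∈ closing d p, Arc.weight w a = ∑ k with p k, w (d k) := by
  have h1 : ∑ᶠ a ∈ closing d p, Arc.weight w a =
      ∑ᶠ a ∈ (fun k => (Sum.inl (d k) : Arc G)) '' {k | p k}, Arc.weight w a := by
    apply finsum_mem_inter_support_eq'
    rintro (a | a) ha
    · constructor
      · rintro (⟨k, hk, e⟩ | ⟨k, r, -, e⟩)
        · exact ⟨k, hk, e.symm⟩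
        · cases e
      · rintro ⟨k, hk, e⟩
        exact Or.inl ⟨k, hk, e.symm⟩
    · exact (ha rfl).elim
  rw [h1, finsum_mem_image (fun k _ j _ h => hd.injective (Sum.inl_injective h)),
    finsum_mem_eq_finite_toFinset_sum _ (Set.toFinite _)]
  exact Finset.sum_congr (by ext; simp) fun _ _ => rfl

/-- A virtual edge which closes a gap between two vertices of a separating set is the only directed
edge used there. -/
theorem notMem_closing_of_ne (hQ : D.IsArcCycle i (closing d p)) {k : ZMod n} {r : ℕ} (h : IsGap p k r) {x y z : V}
    (hx : x = (d k).snd) (hy : y = (d (k + r)).fst) (hxz : x ≠ z) (hyz : y ≠ z) :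
    (Sum.inr (y, z) : Arc G) ∉ closing d p ∧ (Sum.inr (z, y) : Arc G) ∉ closing d p ∧
      (Sum.inr (x, z) : Arc G) ∉ closing d p ∧ (Sum.inr (z, x) : Arc G) ∉ closing d p := by
  subst hx hy
  refine ⟨fun h' => ?_, fun h' => ?_, fun h' => ?_, fun h' => ?_⟩
  · have := hQ.tail_inj h' (inl_mem_closing h.2.1) rfl
    cases this
  · have := hQ.head_inj h' (inr_mem_closing h) rfl
    exact hxz (Prod.ext_iff.1 (Sum.inr_injective this)).1.symm
  · have := hQ.tail_inj h' (inr_mem_closing h) rfl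
    exact hyz (Prod.ext_iff.1 (Sum.inr_injective this)).2.symm
  · have := hQ.head_inj h' (inl_mem_closing h.1) rfl
    cases this

/-- The directed edges of a gap lie behind one separating set, which contains the ends of the
gap. -/
theorem gap_branch (hd : IsDartCycle d) {br : ι → Finset V}
    (hbr : CliqueSum.IsBranching D.bag Set.univ D.sep i br) {k : ZMod n} {r : ℕ}
    (h : IsGap (fun k => D.home (d k).edge = i) k r) {s : ℕ} (hs : 0 < s) (hsr : s < r) :
    (d k).snd ∈ br (D.home (d (k + s)).edge) ∧
      (d (k + r)).fst ∈ br (D.home (d (k + s)).edge) := by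
  obtain ⟨h1, h2, h3, -, h4⟩ := h
  have hfst : ∀ k, (d k).fst ∈ D.bag (D.home (d k).edge) := fun k =>
    (ComponentTree.home_mem_bag _).1
  have hsnd : ∀ k, (d k).snd ∈ D.bag (D.home (d k).edge) := fun k =>
    (ComponentTree.home_mem_bag _).2
  -- Consecutive edges of the gap share a vertex and neither is drawn in `i`, so they lie behind the
  -- same separating set.
  have hconst : ∀ t : ℕ, t + 1 < r →
      br (D.home (d (k + (t + 1 : ℕ))).edge) = br (D.home (d (k + 1)).edge) := by
    intro t
    induction t with
    | zero => intro; simp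
    | succ t ih =>
      intro ht
      rw [← ih (by omega)]
      have e : (d (k + (t + 1 + 1 : ℕ))).fst = (d (k + (t + 1 : ℕ))).snd := by
        rw [← hd.next]; push_cast; ring_nf
      exact hbr.congr _ trivial (h4 _ (by omega) ht) _ trivial (h4 _ (by omega) (by omega))
        (d (k + (t + 1 + 1 : ℕ))).fst (hfst _) (e ▸ hsnd _)
  have hs1 := hconst (s - 1) (by omega)
  rw [Nat.sub_add_cancel hs] at hs1
  have hr1 := hconst (r - 2) (by omega)
  rw [show r - 2 + 1 = r - 1 by omega] at hr1
  have h41 := h4 1 one_pos (by omega)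
  rw [Nat.cast_one] at h41
  rw [hs1]
  constructor
  · refine hbr.inter _ trivial h41 _ ?_ (h1 ▸ hsnd k)
    rw [← hd.next]; exact hfst _
  · rw [← hr1]
    refine hbr.inter _ trivial (h4 (r - 1) (by omega) (by omega)) _ ?_ (h2 ▸ hfst _)
    have e : k + (r : ZMod n) = k + (r - 1 : ℕ) + 1 := by
      rw [Nat.cast_sub (by omega)]; push_cast; ring
    rw [e, hd.next]
    exact hsnd _

theorem gap_mem_arcs (hd : IsDartCycle d) {br : ι → Finset V}
    (hbr : CliqueSum.IsBranching D.bag Set.univ D.sep i br) {k : ZMod n} {r : ℕ}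
    (h : IsGap (fun k => D.home (d k).edge = i) k r) :
    (Sum.inr ((d k).snd, (d (k + r)).fst) : Arc G) ∈ D.arcs i := by
  have h' := hd.gap_branch hbr h one_pos (by have := h.2.2.1; omega)
  refine ComponentTree.inr_mem_arcs.2 ⟨fun e => ?_, _,
    hbr.sep_br _ trivial (h.2.2.2.2 1 one_pos (by have := h.2.2.1; omega)), h'.1, h'.2⟩
  exact h.not_succ (hd.eq_succ e.symm ▸ h.2.1)

end IsDartCycle

/-! ### Virtual triangles and the faces linked across real edges -/

namespace ComponentTree

variable {V ι : Type*} {G : SimpleGraph V} {D : ComponentTree G ι} {i : ι}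

/-- Cyclic relabelling puts any chosen edge of the triangle first, which saves case distinctions
later. -/
theorem IsVirtualTriangle.exists_of_mem {τ : Finset V} {f : Set (Arc G)}
    (h : IsVirtualTriangle τ f) {a : Arc G} (ha : a ∈ f) :
    ∃ x y z : V, x ≠ y ∧ y ≠ z ∧ x ≠ z ∧ (τ : Set V) = {x, y, z} ∧
      f = {Sum.inr (x, y), Sum.inr (y, z), Sum.inr (z, x)} ∧ a = Sum.inr (x, y) := by
  obtain ⟨x, y, z, hxy, hyz, hxz, hτ, rfl⟩ := h
  rcases ha with rfl | rfl | rfl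
  · exact ⟨x, y, z, hxy, hyz, hxz, hτ, rfl, rfl⟩
  · refine ⟨y, z, x, hyz, hxz.symm, hxy.symm, ?_, ?_, rfl⟩
    · rw [hτ]; ext; simp; tauto
    · ext; simp; tauto
  · refine ⟨z, x, y, hxz.symm, hxy, hyz.symm, ?_, ?_, rfl⟩
    · rw [hτ]; ext; simp; tauto
    · ext; simp; tauto

theorem IsVirtualTriangle.mem_of_inr_mem {τ : Finset V} {f : Set (Arc G)}
    (h : IsVirtualTriangle τ f) {x y : V} (ha : Sum.inr (x, y) ∈ f) : x ∈ τ ∧ y ∈ τ := by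
  obtain ⟨x', y', z, -, -, -, hτ, -, e⟩ := h.exists_of_mem ha
  obtain ⟨rfl, rfl⟩ := Prod.ext_iff.1 (Sum.inr_injective e)
  exact ⟨by change x ∈ (τ : Set V); simp [hτ], by change y ∈ (τ : Set V); simp [hτ]⟩

theorem IsVirtualTriangle.rev_notMem {τ : Finset V} {f : Set (Arc G)}
    (h : IsVirtualTriangle τ f) {a : Arc G} (ha : a ∈ f) : Arc.rev a ∉ f := by
  obtain ⟨x, y, z, hxy, hyz, hxz, -, rfl, rfl⟩ := h.exists_of_mem ha
  simp [hxy, hyz, hxz, hxy.symm]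

theorem IsVirtualTriangle.mem_or_rev_mem {τ : Finset V} {f : Set (Arc G)}
    (h : IsVirtualTriangle τ f) {x y : V} (hx : x ∈ τ) (hy : y ∈ τ) (hxy : x ≠ y) :
    (Sum.inr (x, y) : Arc G) ∈ f ∨ (Sum.inr (y, x) : Arc G) ∈ f := by
  obtain ⟨x', y', z', -, -, -, hτ, rfl⟩ := h
  have hx' : x ∈ ({x', y', z'} : Set V) := hτ ▸ hx
  have hy' : y ∈ ({x', y', z'} : Set V) := hτ ▸ hy
  rcases hx' with rfl | rfl | rfl <;> rcases hy' with rfl | rfl | rfl <;> simp_all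

/-- `f` is not the boundary of a virtual triangle of the component `i`. -/
def NonVirtual (D : ComponentTree G ι) (i : ι) (f : Set (Arc G)) : Prop :=
  ¬ ∃ τ, D.sep i τ ∧ IsVirtualTriangle τ f

namespace PlaneEmbedding

variable (E : D.PlaneEmbedding i)

/-- Two faces that share a real edge. -/
def RealLink (f f' : Set (Arc G)) : Prop :=
  ∃ d : G.Dart, D.home d.edge = i ∧ E.face (Sum.inl d) = f ∧ E.face (Sum.inl d.symm) = f'

variable [Finite V]

/-- A function of the faces that only changes across virtual edges does not change around a vertex
`v` of a separating set `τ`, as long as no virtual edge is met. -/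
theorem rotation_const_of_real
    (hone : ∀ i σ τ v, D.sep i σ → D.sep i τ → v ∈ σ → v ∈ τ → σ = τ)
    {β : Type*} (g : Set (Arc G) → β)
    (hg : ∀ d : G.Dart, D.home d.edge = i → g (E.face (Sum.inl d)) = g (E.face (Sum.inl d.symm)))
    {τ : Finset V} (hτ : D.sep i τ) {u v w : V} (hu : u ∈ τ) (hv : v ∈ τ) (hw : w ∈ τ)
    (huv : u ≠ v) (hvw : v ≠ w) (hall : ∀ z ∈ τ, z ≠ v → z = u ∨ z = w) :
    g (E.face (Sum.inr (u, v))) = g (E.face (Sum.inr (v, w))) := by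
  refine E.rotation_const g (inr_mem_arcs.2 ⟨huv, τ, hτ, hu, hv⟩)
    (inr_mem_arcs.2 ⟨hvw, τ, hτ, hv, hw⟩) rfl ?_
  rintro (d | ⟨x, y⟩) he ht h1 h2
  · exact hg d (inl_mem_arcs.1 he)
  · obtain rfl : x = v := ht
    obtain ⟨hxy, σ, hσ, hx, hy⟩ := inr_mem_arcs.1 he
    obtain rfl := hone i σ τ x hσ hτ hx hv
    rcases hall y hy hxy.symm with rfl | rfl
    · exact (h2 rfl).elim
    · exact (h1 rfl).elim

/-- Every face other than the virtual triangles can be reached from the outer face across real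
edges. -/
theorem reflTransGen_realLink
    (hconn : ∀ u ∈ D.bag i, ∀ v ∈ D.bag i, Relation.ReflTransGen (D.Link i) u v)
    (hone : ∀ i σ τ v, D.sep i σ → D.sep i τ → v ∈ σ → v ∈ τ → σ = τ)
    (htri : ∀ τ, D.sep i τ → τ.card = 3 → ∃ f, E.IsInnerFace f ∧ IsVirtualTriangle τ f)
    {f : Set (Arc G)} (hf : f ∈ D.faces i E.rot) (hnv : D.NonVirtual i f) :
    Relation.ReflTransGen E.RealLink E.outer f := by
  rcases (D.arcs i).eq_empty_or_nonempty with h0 | hne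
  · have key : ∀ f' ∈ D.faces i E.rot, f' = ∅ := by
      rintro f' (⟨a, ha, -⟩ | ⟨-, h⟩)
      · rw [h0] at ha; exact ha.elim
      · exact h
    rw [key f hf, key _ E.outer_mem]
  set h : Set (Arc G) → Prop := Relation.ReflTransGen E.RealLink E.outer with hh
  have hreal : ∀ d : G.Dart, D.home d.edge = i →
      h (E.face (Sum.inl d)) = h (E.face (Sum.inl d.symm)) := by
    intro d hd
    refine propext ⟨fun h' => h'.tail ⟨d, hd, rfl, rfl⟩, fun h' => h'.tail ⟨d.symm, ?_, rfl, ?_⟩⟩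
    · simpa using hd
    · simp
  choose! T hTin hT using htri
  let inT : Arc G → Prop := fun a => ∃ τ, D.sep i τ ∧ τ.card = 3 ∧ a ∈ T τ
  have hTface : ∀ τ, D.sep i τ → τ.card = 3 → ∀ a ∈ T τ, a ∈ D.arcs i ∧ T τ = E.face a :=
    fun τ h1 h2 a ha => E.eq_face_of_mem (hTin τ h1 h2).1 ha
  have hTrev : ∀ a, inT a → ¬ inT (Arc.rev a) := by
    rintro a ⟨τ, h1, h2, h3⟩ ⟨σ, h1', h2', h3'⟩
    obtain ⟨x, y, z, -, -, -, hτ, -, rfl⟩ := (hT τ h1 h2).exists_of_mem h3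
    have e := hone i σ τ x h1' h1 ((hT σ h1' h2').mem_of_inr_mem h3').2
      ((hT τ h1 h2).mem_of_inr_mem h3).1
    subst e
    exact (hT σ h1 h2).rev_notMem h3 h3'
  -- On the inner side of a virtual triangle the face across the edge is consulted instead, so `p`
  -- ignores the virtual triangles. It will be invariant under reversal and under steps along faces,
  -- hence the same for all directed edges.
  let p : Arc G → Prop := fun a =>
    (inT a ∧ h (E.face (Arc.rev a))) ∨ (¬ inT a ∧ h (E.face a))
  have prev : ∀ c ∈ D.arcs i, p c → p (Arc.rev c) := by
    rintro c hc (⟨h1, h2⟩ | ⟨h1, h2⟩)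
    · exact Or.inr ⟨hTrev c h1, h2⟩
    · by_cases h3 : inT (Arc.rev c)
      · exact Or.inl ⟨h3, by rwa [Arc.rev_rev]⟩
      · refine Or.inr ⟨h3, ?_⟩
        rcases c with d | ⟨x, y⟩
        · rw [Arc.rev_inl, ← hreal d (inl_mem_arcs.1 hc)]; exact h2
        · obtain ⟨hxy, τ, hτ, hx, hy⟩ := inr_mem_arcs.1 hc
          rcases sep_card hτ with h4 | h4
          -- For a separating pair, a full turn around `y` leads from one side of the virtual edge
          -- to the other and crosses only real edges.
          · rw [Arc.rev_inr, ← E.rotation_const_of_real hone h hreal hτ hx hy hx hxy hxy.symm ?_]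
            · exact h2
            · intro z hz hzy
              classical
              obtain ⟨u, v, huv, rfl⟩ := Finset.card_eq_two.1 h4
              simp only [Finset.mem_insert, Finset.mem_singleton] at hx hy hz
              grind
          · rcases (hT τ hτ h4).mem_or_rev_mem hx hy hxy with h5 | h5
            · exact (h1 ⟨τ, hτ, h4, h5⟩).elim
            · exact (h3 ⟨τ, hτ, h4, h5⟩).elim
  have pstep : ∀ c ∈ D.arcs i, p c → p (E.rot (Arc.rev c)) := by
    rintro c hc (⟨⟨τ, hτ, h4, h1⟩, h2⟩ | ⟨h1, h2⟩)
    · have hmem : E.rot (Arc.rev c) ∈ T τ := by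
        rw [(hTface τ hτ h4 c h1).2, ← E.face_rot_rev c]; exact E.mem_face _
      refine Or.inl ⟨⟨τ, hτ, h4, hmem⟩, ?_⟩
      have htail := (E.rot_spec (rev_mem_arcs hc)).2
      obtain ⟨x, y, z, hxy, hyz, hxz, hτ', hTe, rfl⟩ := (hT τ hτ h4).exists_of_mem h1
      have e : E.rot (Arc.rev (Sum.inr (x, y))) = Sum.inr (y, z) := by
        rw [hTe] at hmem
        rcases hmem with h' | h' | h' <;> rw [h'] at htail
        · exact (hxy htail).elim
        · exact h'
        · exact (hyz.symm htail).elim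
      have m : ∀ v, v ∈ τ ↔ v = x ∨ v = y ∨ v = z := fun v => by
        change v ∈ (τ : Set V) ↔ _; simp [hτ']
      -- The faces across two consecutive sides of the triangle are separated at `y` by real edges
      -- only.
      rw [e, Arc.rev_inr, E.rotation_const_of_real hone h hreal hτ (u := z) (v := y) (w := x)
        (by simp [m]) (by simp [m]) (by simp [m]) hyz.symm hxy.symm ?_]
      · exact h2
      · intro v hv hvy
        rcases (m v).1 hv with rfl | rfl | rfl
        · exact Or.inr rfl
        · exact (hvy rfl).elim
        · exact Or.inl rfl
    · refine Or.inr ⟨?_, by rwa [E.face_rot_rev]⟩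
      rintro ⟨τ, hτ, h4, h5⟩
      refine h1 ⟨τ, hτ, h4, ?_⟩
      rw [(hTface τ hτ h4 _ h5).2, E.face_rot_rev]
      exact E.mem_face c
  obtain ⟨o, ho, hout⟩ := E.exists_eq_face hne E.outer_mem
  obtain ⟨b, hb, rfl⟩ := E.exists_eq_face hne hf
  have hpo : p o := by
    refine Or.inr ⟨?_, hout ▸ Relation.ReflTransGen.refl⟩
    rintro ⟨τ, hτ, h4, h5⟩
    exact (hTin τ hτ h4).2 ((hTface τ hτ h4 o h5).2.trans hout.symm)
  have hpb : p b := E.arc_induction hconn ho hb hpo prev (fun c hc hpc => by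
    simpa using pstep _ (rev_mem_arcs hc) (prev c hc hpc))
  rcases hpb with ⟨⟨τ, hτ, h4, h5⟩, -⟩ | ⟨-, h'⟩
  · exact (hnv ⟨τ, hτ, (hTface τ hτ h4 b h5).2 ▸ hT τ hτ h4⟩).elim
  · exact h'

end PlaneEmbedding

end ComponentTree

/-! ### Prescribing the circulations of faces -/

section faceCirculation

variable {V : Type*} {G : SimpleGraph V} [Finite V]

theorem faceCirculation_add (u w : EdgeWeight G) (f : Set (Arc G)) :
    faceCirculation (u + w) f = faceCirculation u f + faceCirculation w f := by
  simp only [faceCirculation]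
  rw [← finsum_mem_add_distrib (Set.toFinite f)]
  refine finsum_mem_congr rfl fun a _ => ?_
  rcases a with d | p <;> simp

theorem faceCirculation_smul (t : ℤ) (w : EdgeWeight G) (f : Set (Arc G)) :
    faceCirculation (t • w) f = t * faceCirculation w f := by
  simp only [faceCirculation]
  rw [finsum_mem_eq_finite_toFinset_sum _ (Set.toFinite f),
    finsum_mem_eq_finite_toFinset_sum _ (Set.toFinite f), Finset.mul_sum]
  refine Finset.sum_congr rfl fun a _ => ?_
  rcases a with d | p <;> simp

open scoped Classical in
theorem faceCirculation_single_sub_single (d e : G.Dart) (f : Set (Arc G)) :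
    faceCirculation (fun d' => (if d' = d then 1 else 0) - (if d' = e then 1 else 0)) f =
      (if Sum.inl d ∈ f then 1 else 0) - (if Sum.inl e ∈ f then 1 else 0) := by
  simp only [faceCirculation]
  rw [finsum_mem_eq_finite_toFinset_sum _ (Set.toFinite f)]
  have : ∀ a : Arc G,
      Arc.weight (fun d' => (if d' = d then 1 else 0) - (if d' = e then 1 else 0)) a =
        (if a = Sum.inl d then 1 else 0) - (if a = Sum.inl e then 1 else 0) := by
    rintro (a | p) <;> simp
  simp only [this, Finset.sum_sub_distrib, Finset.sum_ite_eq', Set.Finite.mem_toFinset]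

end faceCirculation

namespace ComponentTree.PlaneEmbedding

variable {V ι : Type*} {G : SimpleGraph V} {D : ComponentTree G ι} {i : ι}
  (E : D.PlaneEmbedding i) [Finite V]

-- One unit of circulation is carried along the path of faces: every real edge crossed takes it from
-- the face left and gives it to the face entered.
open scoped Classical in
theorem exists_unit_weight {f : Set (Arc G)}
    (hf : Relation.ReflTransGen E.RealLink E.outer f) :
    ∃ u : EdgeWeight G, u.SkewSymmetric ∧ ∀ f' ∈ D.faces i E.rot,
      faceCirculation u f' = (if f' = f then 1 else 0) - (if f' = E.outer then 1 else 0) := by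
  induction hf with
  | refl =>
    refine ⟨0, fun d => by simp, fun f' _ => ?_⟩
    have := faceCirculation_smul (0 : ℤ) (0 : EdgeWeight G) f'
    simpa using this
  | tail _ h ih =>
    obtain ⟨u, hu, hcirc⟩ := ih
    obtain ⟨d, -, rfl, rfl⟩ := h
    refine ⟨u + fun d' => (if d' = d.symm then 1 else 0) - (if d' = d then 1 else 0),
      fun d' => ?_, fun f' hf' => ?_⟩
    · have e1 : d'.symm = d.symm ↔ d' = d :=
        ⟨fun h => SimpleGraph.Dart.symm_involutive.injective h, fun h => h ▸ rfl⟩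
      have e2 : d'.symm = d ↔ d' = d.symm :=
        ⟨fun h => by rw [← h, SimpleGraph.Dart.symm_symm],
          fun h => by rw [h, SimpleGraph.Dart.symm_symm]⟩
      simp only [Pi.add_apply, hu d', e1, e2]
      ring
    · rw [faceCirculation_add, hcirc f' hf', faceCirculation_single_sub_single]
      have m : ∀ a, a ∈ f' ↔ f' = E.face a := fun a =>
        ⟨fun h => (E.eq_face_of_mem hf' h).2, fun h => h ▸ E.mem_face a⟩
      simp only [m]
      ring

/-- The circulations of the inner faces other than the virtual triangles may be prescribed. -/
theorem exists_weight
    (hconn : ∀ u ∈ D.bag i, ∀ v ∈ D.bag i, Relation.ReflTransGen (D.Link i) u v)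
    (hone : ∀ i σ τ v, D.sep i σ → D.sep i τ → v ∈ σ → v ∈ τ → σ = τ)
    (htri : ∀ τ, D.sep i τ → τ.card = 3 → ∃ f, E.IsInnerFace f ∧ IsVirtualTriangle τ f)
    (t : Set (Arc G) → ℤ) :
    ∃ u : EdgeWeight G, u.SkewSymmetric ∧
      ∀ f, E.IsInnerFace f → D.NonVirtual i f → faceCirculation u f = t f := by
  classical
  -- Unit weights are superposed face by face; all deficits collect at the outer face, where nothing
  -- is prescribed.
  have key : ∀ S : Finset (Set (Arc G)),
      (∀ f ∈ S, f ∈ D.faces i E.rot ∧ D.NonVirtual i f) →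
      ∃ u : EdgeWeight G, u.SkewSymmetric ∧
        ∀ f, E.IsInnerFace f → faceCirculation u f = if f ∈ S then t f else 0 := by
    intro S
    induction S using Finset.induction_on with
    | empty =>
      intro _
      refine ⟨0, fun d => by simp, fun f' _ => ?_⟩
      have := faceCirculation_smul (0 : ℤ) (0 : EdgeWeight G) f'
      simpa using this
    | insert f S hfS ih =>
      intro hS
      obtain ⟨u, hu, huc⟩ := ih fun f hf => hS f (Finset.mem_insert_of_mem hf)
      obtain ⟨hf, hfv⟩ := hS f (Finset.mem_insert_self _ _)
      obtain ⟨e, he, hec⟩ :=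
        E.exists_unit_weight (E.reflTransGen_realLink hconn hone htri hf hfv)
      refine ⟨u + t f • e, fun d => ?_, fun f' hf' => ?_⟩
      · simp only [Pi.add_apply, Pi.smul_apply, hu d, he d, smul_eq_mul]; ring
      · rw [faceCirculation_add, faceCirculation_smul, huc f' hf', hec f' hf'.1]
        by_cases h : f' = f
        · subst h; simp [hfS, hf'.2]
        · simp [h, hf'.2]
  let _ : Fintype (Set (Arc G)) := Fintype.ofFinite _
  obtain ⟨u, hu, huc⟩ := key
    (Finset.univ.filter fun f => f ∈ D.faces i E.rot ∧ D.NonVirtual i f) (by simp)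
  refine ⟨u, hu, fun f hf hfv => ?_⟩
  rw [huc f hf, if_pos (by simp [hf.1, hfv])]

end ComponentTree.PlaneEmbedding

/-! ### Combinatorics of the working tree -/

namespace WorkingTree

variable {ι : Type*} {S : SimpleGraph ι} {center : Set ι → ι} {A B B' : Set ι}

theorem Child.nonempty (h : Child S center A B) : B.Nonempty := by
  obtain ⟨C, rfl⟩ := h
  exact C.nonempty_supp.image _

theorem Child.subset_diff (h : Child S center A B) : B ⊆ A \ {center A} := by
  obtain ⟨C, rfl⟩ := h
  rintro _ ⟨x, -, rfl⟩
  exact x.2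

theorem Child.subset (h : Child S center A B) : B ⊆ A := fun _ hx => (h.subset_diff hx).1

theorem Child.center_notMem (h : Child S center A B) : center A ∉ B :=
  fun hx => (h.subset_diff hx).2 rfl

theorem Child.eq_of_mem (h : Child S center A B) (h' : Child S center A B') {x : ι} (hx : x ∈ B)
    (hx' : x ∈ B') : B = B' := by
  obtain ⟨C, rfl⟩ := h
  obtain ⟨C', rfl⟩ := h'
  obtain ⟨y, hy, rfl⟩ := hx
  obtain ⟨z, hz, e⟩ := hx'
  obtain rfl : z = y := Subtype.ext e
  rw [SimpleGraph.ConnectedComponent.mem_supp_iff] at hy hz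
  rw [← hy, ← hz]

theorem exists_child {x : ι} (hx : x ∈ A) (hne : x ≠ center A) :
    ∃ B, Child S center A B ∧ x ∈ B :=
  ⟨_, ⟨(S.induce (A \ {center A})).connectedComponentMk ⟨x, hx, hne⟩, rfl⟩, ⟨x, hx, hne⟩, rfl, rfl⟩

theorem Child.mem_of_adj (h : Child S center A B) {x y : ι} (hx : x ∈ B) (hy : y ∈ A)
    (hne : y ≠ center A) (hxy : S.Adj x y) : y ∈ B := by
  obtain ⟨C, rfl⟩ := h
  obtain ⟨x, hx, rfl⟩ := hx
  refine ⟨⟨y, hy, hne⟩, ?_, rfl⟩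
  have hadj : (S.induce (A \ {center A})).Adj x ⟨y, hy, hne⟩ := hxy
  exact C.mem_supp_of_adj_mem_supp hx hadj

/-- The node set `A` is connected. -/
def ConnectedIn (S : SimpleGraph ι) (A : Set ι) : Prop :=
  ∀ x ∈ A, ∀ y ∈ A, Relation.ReflTransGen (fun a b => S.Adj a b ∧ a ∈ A ∧ b ∈ A) x y

theorem Child.connectedIn (h : Child S center A B) : ConnectedIn S B := by
  obtain ⟨C, rfl⟩ := h
  rintro _ ⟨x, hx, rfl⟩ _ ⟨y, hy, rfl⟩
  have hr : (S.induce (A \ {center A})).Reachable x y := by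
    rw [SimpleGraph.ConnectedComponent.mem_supp_iff] at hx hy
    exact SimpleGraph.ConnectedComponent.exact (hx.trans hy.symm)
  rw [SimpleGraph.reachable_iff_reflTransGen] at hr
  have : Relation.ReflTransGen
      (fun a b => S.Adj a b ∧ a ∈ Subtype.val '' C.supp ∧ b ∈ Subtype.val '' C.supp) x.1 y.1 ∧
        y ∈ C.supp := by
    clear hy
    induction hr with
    | refl => exact ⟨.refl, hx⟩
    | @tail u v _ h ih =>
      have hv := C.mem_supp_of_adj_mem_supp ih.2 h
      exact ⟨ih.1.tail ⟨h, ⟨u, ih.2, rfl⟩, ⟨v, hv, rfl⟩⟩, hv⟩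
  exact this.1

/-- On a path inside `A` from `B` to the center, the step that leaves `B` can only enter the center.
-/
theorem Child.exists_adj_center (h : Child S center A B) (hA : ConnectedIn S A)
    (hc : center A ∈ A) : ∃ j ∈ B, S.Adj j (center A) := by
  obtain ⟨b, hb⟩ := h.nonempty
  have hp := hA b (h.subset hb) _ hc
  induction hp using Relation.ReflTransGen.head_induction_on with
  | refl => exact (h.center_notMem hb).elim
  | @head x y h' _ ih =>
    by_cases hy : y = center A
    · exact ⟨x, hb, hy ▸ h'.1⟩
    · exact ih (h.mem_of_adj hb h'.2.2 hy h'.1)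

theorem Below.subset (h : Below S center A B) : B ⊆ A := by
  induction h with
  | refl => exact subset_rfl
  | tail _ h ih => exact h.subset.trans ih

theorem Below.nonempty (h : Below S center A B) (hA : A.Nonempty) : B.Nonempty := by
  induction h with
  | refl => exact hA
  | tail _ h _ => exact h.nonempty

theorem Piece.child (hA : Piece S center A) (h : Child S center A B) : Piece S center B :=
  Relation.ReflTransGen.tail hA h

theorem Piece.connectedIn (hA : Piece S center A) (hS : ConnectedIn S Set.univ) :
    ConnectedIn S A := by
  induction hA with
  | refl => exact hS
  | tail _ h _ => exact h.connectedIn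

/-- Siblings are disjoint and a piece's center lies in none of its children, so the descents to `A`
and to `B` cannot diverge. Thus a component determines the piece whose center it is. -/
theorem Below.eq_of_center_eq (hcenter : ∀ A : Set ι, A.Nonempty → center A ∈ A) {R : Set ι}
    (hR : R.Nonempty) (hA : Below S center R A) (hB : Below S center R B)
    (h : center A = center B) : A = B := by
  induction hA using Relation.ReflTransGen.head_induction_on with
  | refl =>
    rcases Relation.ReflTransGen.cases_head hB with e | ⟨C, hC, hCB⟩
    · exact e
    · exact (hC.center_notMem (h ▸ Below.subset hCB
        (hcenter B (Below.nonempty hCB hC.nonempty)))).elim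
  | @head R C hC hCA ih =>
    have hAC := Below.subset hCA (hcenter A (Below.nonempty hCA hC.nonempty))
    rcases Relation.ReflTransGen.cases_head hB with rfl | ⟨C', hC', hCB⟩
    · exact (hC.center_notMem (h ▸ hAC)).elim
    · have hBC := Below.subset hCB (hcenter B (Below.nonempty hCB hC'.nonempty))
      obtain rfl := hC.eq_of_mem hC' hAC (h ▸ hBC)
      exact ih hC.nonempty hCB

/-- The scale `K ^ h * l` at which the subtree with node set `A` is weighted. -/
noncomputable def scale (S : SimpleGraph ι) (center : Set ι → ι) (K : ℕ) (A : Set ι) : ℤ :=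
  (K : ℤ) ^ height S center A * (leaves S center A : ℤ)

theorem scale_nonneg (K : ℕ) (A : Set ι) : 0 ≤ scale S center K A := by
  unfold scale; positivity

variable [Finite ι]

theorem level_lt (hA : Piece S center A) (h : Child S center A B)
    (hc : center A ∈ A) : level S center A < level S center B := by
  refine Set.ncard_lt_ncard ?_ (Set.toFinite _)
  refine ⟨fun C hC => ⟨hC.1, hC.2.tail h⟩, fun hsub => ?_⟩
  have hB : Below S center B A := (hsub ⟨hA.child h, .refl⟩).2
  exact h.center_notMem (Below.subset hB hc)

theorem level_le_maxLevel (hA : Piece S center A) : level S center A ≤ maxLevel S center := by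
  refine le_csSup ?_ ⟨A, hA, rfl⟩
  refine (Set.Finite.subset (Set.finite_range (level S center)) ?_).bddAbove
  rintro _ ⟨A, -, rfl⟩
  exact ⟨A, rfl⟩

/-- Ensures that the exponent `height - 1` is not truncated. -/
theorem one_le_height (hA : Piece S center A) : 1 ≤ height S center A := by
  have := level_le_maxLevel hA
  unfold height
  omega

theorem height_child_le (hA : Piece S center A) (h : Child S center A B) (hc : center A ∈ A) :
    height S center B ≤ height S center A - 1 := by
  have h1 := level_lt hA h hc
  have h2 := level_le_maxLevel (hA.child h)
  unfold height
  omega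

variable (S center) in
/-- The subtrees attached at the root of the subtree with node set `A`. -/
noncomputable def children (A : Set ι) : Finset (Set ι) :=
  (Set.toFinite {B | Child S center A B}).toFinset

@[simp] theorem mem_children : B ∈ children S center A ↔ Child S center A B := by
  simp [children]

/-- Induction on the node sets of the working tree, from the leaves to the root. -/
theorem piece_induction {p : Set ι → Prop} (hcenter : ∀ A : Set ι, A.Nonempty → center A ∈ A)
    (hp : ∀ A, A.Nonempty → (∀ B, Child S center A B → p B) → p A) (A : Set ι)
    (hA : A.Nonempty) : p A := by
  induction hn : A.ncard using Nat.strong_induction_on generalizing A with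
  | _ n ih =>
    refine hp A hA fun B hB => ih _ ?_ B hB.nonempty rfl
    rw [← hn]
    exact Set.ncard_lt_ncard ⟨hB.subset, fun h => hB.center_notMem (h (hcenter A hA))⟩
      (Set.toFinite _)

theorem one_le_leaves (hcenter : ∀ A : Set ι, A.Nonempty → center A ∈ A) (hA : A.Nonempty) :
    1 ≤ leaves S center A := by
  have key : ∃ B, Below S center A B ∧ ∀ B', ¬ Child S center B B' := by
    refine piece_induction (S := S) (center := center) (p := fun A =>
      ∃ B, Below S center A B ∧ ∀ B', ¬ Child S center B B') hcenter ?_ A hA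
    intro A hA ih
    by_cases h : ∃ B, Child S center A B
    · obtain ⟨B, hB⟩ := h
      obtain ⟨C, hC, hC'⟩ := ih B hB
      exact ⟨C, Relation.ReflTransGen.head hB hC, hC'⟩
    · exact ⟨A, .refl, by simpa using h⟩
  exact (Set.ncard_pos (Set.toFinite _)).2 key

/-- Subtrees attached at the same node have disjoint node sets, so no leaf is counted twice. -/
theorem sum_leaves_le : ∑ B ∈ children S center A, leaves S center B ≤ leaves S center A := by
  classical
  have h : ∀ B, leaves S center B = (Set.toFinite {C : Set ι | Below S center B C ∧
      ∀ B', ¬ Child S center C B'}).toFinset.card := fun B => by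
    rw [leaves, Set.ncard_eq_toFinset_card _ (Set.toFinite _)]
  rw [Finset.sum_congr rfl fun B _ => h B, h A, ← Finset.card_biUnion]
  · refine Finset.card_le_card fun C hC => ?_
    simp only [Finset.mem_biUnion, mem_children, Set.Finite.mem_toFinset, Set.mem_ofPred_eq] at hC ⊢
    obtain ⟨B, hB, hC, hC'⟩ := hC
    exact ⟨Relation.ReflTransGen.head hB hC, hC'⟩
  · intro B hB B' hB' hne
    rw [Finset.mem_coe, mem_children] at hB hB'
    rw [Function.onFun, Finset.disjoint_left]
    intro C hC hC'
    simp only [Set.Finite.mem_toFinset, Set.mem_ofPred_eq] at hC hC'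
    obtain ⟨x, hx⟩ := Below.nonempty hC.1 hB.nonempty
    exact hne (hB.eq_of_mem hB' (Below.subset hC.1 hx) (Below.subset hC'.1 hx))

/-- Heights drop by at least one and leaves add up. This is the purpose of the factor `leaves`: the
bound does not depend on the number of attached subtrees. -/
theorem sum_scale_le (hcenter : ∀ A : Set ι, A.Nonempty → center A ∈ A) {K : ℕ} (hK : 1 ≤ K)
    (hA : Piece S center A) (hne : A.Nonempty) :
    ∑ B ∈ children S center A, scale S center K B ≤
      (K : ℤ) ^ (height S center A - 1) * (leaves S center A : ℤ) := by
  calc ∑ B ∈ children S center A, scale S center K B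
      ≤ ∑ B ∈ children S center A,
        (K : ℤ) ^ (height S center A - 1) * (leaves S center B : ℤ) := by
        refine Finset.sum_le_sum fun B hB => ?_
        have := height_child_le hA (mem_children.1 hB) (hcenter A hne)
        have hK' : (1 : ℤ) ≤ K := by exact_mod_cast hK
        unfold scale
        gcongr
    _ ≤ _ := by
        rw [← Finset.mul_sum]
        gcongr
        exact_mod_cast sum_leaves_le

end WorkingTree

namespace ComponentTree

open WorkingTree

variable {V ι : Type*} {G : SimpleGraph V} {D : ComponentTree G ι} {N : ι}
  {br : ι → Finset V} {center : Set ι → ι} {A B B' : Set ι}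

/-! ### Children in the working tree and separating sets -/

theorem exists_mem_of_adj {i j : ι} (h : D.tree.Adj i j) : ∃ v, v ∈ D.bag i ∧ v ∈ D.bag j := by
  obtain ⟨-, τ, h1, h2⟩ := h
  obtain ⟨v, hv⟩ := sep_nonempty h1
  exact ⟨v, sep_subset_bag h1 hv, sep_subset_bag h2 hv⟩

theorem branch_eq_of_sep (hone : ∀ i σ τ v, D.sep i σ → D.sep i τ → v ∈ σ → v ∈ τ → σ = τ)
    (hbr : CliqueSum.IsBranching D.bag Set.univ D.sep N br) {j : ι} (hj : j ≠ N) {τ : Finset V}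
    (h : D.sep j τ) (h' : D.sep N τ) : br j = τ := by
  obtain ⟨v, hv⟩ := sep_nonempty h
  exact hone N _ _ v (hbr.sep_br j trivial hj) h'
    (hbr.inter j trivial hj v (sep_subset_bag h hv) (sep_subset_bag h' hv)) hv

/-- Adjacent components of `B` share a vertex and neither is the center, so the branch is constant
along paths in the connected set `B`. -/
theorem branch_eq_of_child (hbr : CliqueSum.IsBranching D.bag Set.univ D.sep (center A) br)
    (hB : Child D.tree center A B) {x y : ι} (hx : x ∈ B) (hy : y ∈ B) : br x = br y := by
  have h := hB.connectedIn x hx y hy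
  induction h with
  | refl => rfl
  | @tail u v _ h ih =>
    obtain ⟨w, hw, hw'⟩ := exists_mem_of_adj h.1
    rw [ih h.2.1]
    exact hbr.congr _ trivial (hB.subset_diff h.2.1).2 _ trivial (hB.subset_diff h.2.2).2 w hw hw'

/-- Some component of `B` is adjacent to the center because the piece `A` is connected; the set
these two share is the common branch of `B`. -/
theorem exists_sep_of_child (hone : ∀ i σ τ v, D.sep i σ → D.sep i τ → v ∈ σ → v ∈ τ → σ = τ)
    (hcenter : ∀ A : Set ι, A.Nonempty → center A ∈ A)
    (hbr : CliqueSum.IsBranching D.bag Set.univ D.sep (center A) br)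
    (hA : Piece D.tree center A) (hB : Child D.tree center A B) {x : ι} (hx : x ∈ B) :
    ∃ j ∈ B, D.sep j (br x) := by
  have hS : ConnectedIn D.tree Set.univ := fun x _ y _ =>
    Relation.ReflTransGen.mono (fun a b h => ⟨h, trivial, trivial⟩) _ _ (tree_preconnected x y)
  obtain ⟨j, hj, -, τ, h1, h2⟩ := hB.exists_adj_center (hA.connectedIn hS)
    (hcenter A ⟨x, hB.subset hx⟩)
  refine ⟨j, hj, ?_⟩
  rw [branch_eq_of_child hbr hB hx hj,
    branch_eq_of_sep hone hbr (hB.subset_diff hj).2 h1 h2]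
  exact h1

/-- Two different children behind the same separating set would give, with the center, three
components sharing it. -/
theorem child_eq_of_branch_eq [Finite ι]
    (hone : ∀ i σ τ v, D.sep i σ → D.sep i τ → v ∈ σ → v ∈ τ → σ = τ)
    (htwo : ∀ τ, {i | D.sep i τ}.ncard ≤ 2)
    (hcenter : ∀ A : Set ι, A.Nonempty → center A ∈ A)
    (hbr : CliqueSum.IsBranching D.bag Set.univ D.sep (center A) br)
    (hA : Piece D.tree center A) (hB : Child D.tree center A B) (hB' : Child D.tree center A B')
    {x y : ι} (hx : x ∈ B) (hy : y ∈ B') (h : br x = br y) : B = B' := by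
  obtain ⟨j, hj, h1⟩ := exists_sep_of_child hone hcenter hbr hA hB hx
  obtain ⟨k, hk, h2⟩ := exists_sep_of_child hone hcenter hbr hA hB' hy
  by_cases hjk : j = k
  · exact hB.eq_of_mem hB' hj (hjk ▸ hk)
  have hjN := (hB.subset_diff hj).2
  have hkN := (hB'.subset_diff hk).2
  have hsub : ({center A, j, k} : Set ι) ⊆ {i | D.sep i (br x)} := by
    rintro i (rfl | rfl | rfl)
    · exact hbr.sep_br x trivial (hB.subset_diff hx).2
    · exact h1
    · rw [← h] at h2; exact h2
  have h3 : ({center A, j, k} : Set ι).ncard = 3 :=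
    Set.ncard_eq_three.2 ⟨_, _, _, fun h => hjN h.symm, fun h => hkN h.symm, hjk, rfl⟩
  have := Set.ncard_le_ncard hsub (Set.toFinite _)
  have := htwo (br x)
  omega

theorem adjacentToAttachment_iff
    (hone : ∀ i σ τ v, D.sep i σ → D.sep i τ → v ∈ σ → v ∈ τ → σ = τ)
    (hcenter : ∀ A : Set ι, A.Nonempty → center A ∈ A)
    (hbr : CliqueSum.IsBranching D.bag Set.univ D.sep (center A) br)
    (hA : Piece D.tree center A) (hB : Child D.tree center A B) {x : ι} (hx : x ∈ B)
    (f : Set (Arc G)) : D.AdjacentToAttachment center A B f ↔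
      ∃ u ∈ br x, ∃ v ∈ br x, Sum.inr (u, v) ∈ f := by
  constructor
  · rintro ⟨τ, h1, ⟨j, hj, h2⟩, h3⟩
    rwa [branch_eq_of_child hbr hB hx hj,
      branch_eq_of_sep hone hbr (hB.subset_diff hj).2 h2 h1]
  · exact fun h => ⟨br x, hbr.sep_br x trivial (hB.subset_diff hx).2,
      exists_sep_of_child hone hcenter hbr hA hB hx, h⟩

/-! ### Faces inside a cycle -/

theorem IsVirtualTriangle.faceCirculation_eq_zero {τ : Finset V} {f : Set (Arc G)}
    (h : IsVirtualTriangle τ f) (w : EdgeWeight G) : faceCirculation w f = 0 := by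
  refine finsum_mem_eq_zero_of_forall_eq_zero fun a ha => ?_
  obtain ⟨x, y, z, -, -, -, -, -, rfl⟩ := h.exists_of_mem ha
  rfl

/-- The faces of the component `N` inside the cycle `d`. -/
theorem exists_faces_inside [Finite V] (hG : G.Connected)
    (hone : ∀ i σ τ v, D.sep i σ → D.sep i τ → v ∈ σ → v ∈ τ → σ = τ)
    (hbr : CliqueSum.IsBranching D.bag Set.univ D.sep N br) (E : D.PlaneEmbedding N)
    {n : ℕ} [NeZero n] {d : ZMod n → G.Dart} (hd : IsDartCycle d) {k₀ : ZMod n}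
    (hk₀ : D.home (d k₀).edge = N) [DecidablePred fun k => D.home (d k).edge = N] :
    ∃ (I : Set (Set (Arc G))) (s : ℤ), (s = 1 ∨ s = -1) ∧ (∀ f ∈ I, E.IsInnerFace f) ∧
      (∀ w : EdgeWeight G, w.SkewSymmetric →
        ∑ k with D.home (d k).edge = N, w (d k) = s * ∑ᶠ f ∈ I, faceCirculation w f) ∧
      (∃ f ∈ I, D.NonVirtual N f) ∧
      ∀ k, D.home (d k).edge ≠ N → ∃ f ∈ I, D.NonVirtual N f ∧
        ∃ u ∈ br (D.home (d k).edge), ∃ v ∈ br (D.home (d k).edge), Sum.inr (u, v) ∈ f := by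
  classical
  have hconn : ∀ u ∈ D.bag N, ∀ v ∈ D.bag N, Relation.ReflTransGen (D.Link N) u v :=
    fun u hu v hv => link_connected hG hone hu hv
  have hQ := hd.isArcCycle_closing (D := D) (i := N) (fun _ h => h)
    (fun k r h => hd.gap_mem_arcs hbr h) hk₀
  obtain ⟨I, s, hs, hI, hQI⟩ := E.exists_interior hconn hQ
  -- At an edge of the closed cycle exactly one of the two sides is inside.
  have hone_side : ∀ a ∈ IsDartCycle.closing d (fun k => D.home (d k).edge = N),
      (E.face a ∈ I ∧ E.face (Arc.rev a) ∉ I) ∨ (E.face a ∉ I ∧ E.face (Arc.rev a) ∈ I) := by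
    intro a ha
    have := hQI a (hQ.subset ha)
    simp only [ha, hQ.rev_notMem a ha, if_true, if_false] at this
    by_cases h1 : E.face a ∈ I <;> by_cases h2 : E.face (Arc.rev a) ∈ I <;> simp_all
  have hsame : ∀ a ∈ D.arcs N, a ∉ IsDartCycle.closing d (fun k => D.home (d k).edge = N) →
      Arc.rev a ∉ IsDartCycle.closing d (fun k => D.home (d k).edge = N) →
      E.face a ∈ I → E.face (Arc.rev a) ∈ I := by
    intro a ha h1 h2 h3
    have := hQI a ha
    by_contra h4
    simp only [h1, h2, h3, h4, if_true, if_false] at this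
    rcases hs with rfl | rfl <;> simp at this
  refine ⟨I, s, hs, hI, fun w hw => ?_, ?_, fun k hk => ?_⟩
  · rw [← E.sum_weight_eq hQ hI hQI hw, hd.finsum_closing]
  · have hreal : ∀ e : G.Dart, D.NonVirtual N (E.face (Sum.inl e)) := by
      rintro e ⟨τ, -, h⟩
      obtain ⟨x, y, z, -, -, -, -, -, h'⟩ := h.exists_of_mem (E.mem_face _)
      cases h'
    rcases hone_side _ (IsDartCycle.inl_mem_closing hk₀) with h | h
    · exact ⟨_, h.1, hreal _⟩
    · exact ⟨_, h.2, hreal _⟩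
  · obtain ⟨k₁, r, hr, t, ht, htr, rfl⟩ :=
      IsGap.exists_around (p := fun k => D.home (d k).edge = N) hk₀ hk
    obtain ⟨hx, hy⟩ := hd.gap_branch hbr hr ht htr
    have hτ := hbr.sep_br _ trivial hk
    set τ := br (D.home (d (k₁ + t)).edge)
    have hxQ := IsDartCycle.inr_mem_closing (d := d) hr
    set x := (d k₁).snd with hx'
    set y := (d (k₁ + r)).fst with hy'
    -- the inner one of the two faces at the virtual edge
    obtain ⟨u, v, hu, hv, huv, hin, hout⟩ : ∃ u v, u ∈ τ ∧ v ∈ τ ∧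
        ((u = x ∧ v = y) ∨ (u = y ∧ v = x)) ∧ E.face (Sum.inr (u, v)) ∈ I ∧
          E.face (Sum.inr (v, u)) ∉ I := by
      rcases hone_side _ hxQ with h | h
      · exact ⟨x, y, hx, hy, Or.inl ⟨rfl, rfl⟩, h⟩
      · exact ⟨y, x, hy, hx, Or.inr ⟨rfl, rfl⟩, h.2, h.1⟩
    by_cases hnv : D.NonVirtual N (E.face (Sum.inr (u, v)))
    · exact ⟨_, hin, hnv, u, hu, v, hv, E.mem_face _⟩
    -- If the inner side is the virtual triangle, another of its edges is crossed. The closed cycle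
    -- does not use that edge, so the face beyond it is inside as well.
    obtain ⟨σ, hσ, hT⟩ := not_not.1 hnv
    obtain rfl : σ = τ := hone N σ τ u hσ hτ (hT.mem_of_inr_mem (E.mem_face _)).1 hu
    obtain ⟨u', v', z, h1, h2, h3, hτ', hF, e⟩ := hT.exists_of_mem (E.mem_face _)
    obtain ⟨rfl, rfl⟩ := Prod.ext_iff.1 (Sum.inr_injective e)
    have hz : z ∈ τ := by change z ∈ (τ : Set V); simp [hτ']
    have hvzF : (Sum.inr (v, z) : Arc G) ∈ E.face (Sum.inr (u, v)) := by rw [hF]; simp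
    have hvz : E.face (Sum.inr (v, z)) ∈ I := by
      rw [E.face_eq_of_mem hvzF]; exact hin
    have hnQ : (Sum.inr (v, z) : Arc G) ∉
          IsDartCycle.closing d (fun k => D.home (d k).edge = N) ∧
        (Sum.inr (z, v) : Arc G) ∉ IsDartCycle.closing d (fun k => D.home (d k).edge = N) := by
      rcases huv with ⟨rfl, rfl⟩ | ⟨rfl, rfl⟩
      · have := IsDartCycle.notMem_closing_of_ne hQ hr hx' hy' h3 h2
        exact ⟨this.1, this.2.1⟩
      · have := IsDartCycle.notMem_closing_of_ne hQ hr hx' hy' h2 h3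
        exact ⟨this.2.2.1, this.2.2.2⟩
    have hzv := hsame _ (inr_mem_arcs.2 ⟨h2, τ, hτ, hv, hz⟩) hnQ.1 hnQ.2 hvz
    rw [Arc.rev_inr] at hzv
    refine ⟨_, hzv, ?_, z, hz, v, hv, E.mem_face _⟩
    -- A second virtual triangle there would contain `(u, v)` and so be the first one, or contain
    -- `(v, u)`, whose face is not inside.
    rintro ⟨ρ, hρ, hT'⟩
    obtain rfl : ρ = τ := hone N ρ τ z hρ hτ (hT'.mem_of_inr_mem (E.mem_face _)).1 hz
    rcases hT'.mem_or_rev_mem hu hv h1 with h | h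
    · have h5 : (Sum.inr (v, z) : Arc G) ∈ E.face (Sum.inr (z, v)) := by
        rw [← E.face_eq_of_mem h]; exact hvzF
      exact hT'.rev_notMem (E.mem_face _) h5
    · rw [← E.face_eq_of_mem h] at hzv
      exact hout hzv

open scoped Classical in
/-- At most three faces other than virtual triangles are adjacent to a separating set. -/
theorem card_faces_le_three [Finite V]
    (E : D.PlaneEmbedding N)
    (htri : ∀ τ, D.sep N τ → τ.card = 3 → ∃ f, E.IsInnerFace f ∧ IsVirtualTriangle τ f)
    {τ : Finset V} (hτ : D.sep N τ) (F : Finset (Set (Arc G)))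
    (hF : ∀ f ∈ F, f ∈ D.faces N E.rot ∧ D.NonVirtual N f ∧
      ∃ u ∈ τ, ∃ v ∈ τ, Sum.inr (u, v) ∈ f) : F.card ≤ 3 := by
  rcases sep_card hτ with h2 | h3
  · obtain ⟨x, y, -, rfl⟩ := Finset.card_eq_two.1 h2
    have hsub : F ⊆ {E.face (Sum.inr (x, y)), E.face (Sum.inr (y, x))} := by
      intro f hf
      obtain ⟨hf, -, u, hu, v, hv, huv⟩ := hF f hf
      obtain ⟨ha, rfl⟩ := E.eq_face_of_mem hf huv
      have hne := (inr_mem_arcs.1 ha).1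
      simp only [Finset.mem_insert, Finset.mem_singleton] at hu hv ⊢
      rcases hu with rfl | rfl <;> rcases hv with rfl | rfl <;> simp_all
    exact (Finset.card_le_card hsub).trans (Finset.card_le_two.trans (by norm_num))
  -- One side of each of the three virtual edges is the excluded triangle itself, so only the three
  -- other sides remain.
  · obtain ⟨T, hTin, hT⟩ := htri τ hτ h3
    obtain ⟨x, y, z, -, -, -, hτ', hTe⟩ := id hT
    have hsub : F ⊆
        {E.face (Sum.inr (y, x)), E.face (Sum.inr (z, y)), E.face (Sum.inr (x, z))} := by
      intro f hf
      obtain ⟨hf, hnv, u, hu, v, hv, huv⟩ := hF f hf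
      obtain ⟨ha, rfl⟩ := E.eq_face_of_mem hf huv
      have hne := (inr_mem_arcs.1 ha).1
      have hnT : (Sum.inr (u, v) : Arc G) ∉ T := fun h =>
        hnv ⟨τ, hτ, (E.eq_face_of_mem hTin.1 h).2 ▸ hT⟩
      have hvT := (hT.mem_or_rev_mem hu hv hne).resolve_left hnT
      rw [hTe] at hvT
      simp only [Finset.mem_insert, Finset.mem_singleton]
      rcases hvT with h | h | h <;>
        obtain ⟨rfl, rfl⟩ := Prod.ext_iff.1 (Sum.inr_injective h) <;> simp
    exact (Finset.card_le_card hsub).trans Finset.card_le_three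

end ComponentTree

/-! ### Sums of powers of two -/

/-- Powers of two with distinct positive exponents do not cancel. -/
theorem two_mul_le_abs_sum {κ : Type*} (R : Finset κ) (hR : R.Nonempty) (e : κ → ℕ)
    (he : Set.InjOn e R) (hpos : ∀ k ∈ R, 1 ≤ e k) (x : κ → ℤ) {c : ℤ} (hc : 0 < c)
    (hx : ∀ k ∈ R, |x k| = 2 ^ e k * c) : 2 * c ≤ |∑ k ∈ R, x k| := by
  classical
  -- All other terms are divisible by twice the power with the smallest exponent, so the sum is an
  -- odd multiple of `2 ^ e k₀ * c`.
  obtain ⟨k₀, hk₀, hmin⟩ := R.exists_min_image e hR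
  have hdvd : (2 ^ (e k₀ + 1) * c : ℤ) ∣ ∑ k ∈ R.erase k₀, x k := by
    refine Finset.dvd_sum fun k hk => ?_
    obtain ⟨hne, hk⟩ := Finset.mem_erase.1 hk
    have hlt : e k₀ < e k :=
      lt_of_le_of_ne (hmin k hk) fun h => hne (he hk hk₀ h.symm)
    rw [← dvd_abs, hx k hk]
    exact mul_dvd_mul_right (pow_dvd_pow 2 hlt) c
  obtain ⟨q, hq⟩ := hdvd
  rw [← Finset.add_sum_erase R x hk₀, hq]
  have h2 : (2 : ℤ) ≤ 2 ^ e k₀ := by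
    calc (2 : ℤ) = 2 ^ 1 := by norm_num
      _ ≤ 2 ^ e k₀ := pow_le_pow_right₀ (by norm_num) (hpos k₀ hk₀)
  obtain ⟨ε, hε, hxε⟩ : ∃ ε : ℤ, (ε = 1 ∨ ε = -1) ∧ x k₀ = 2 ^ e k₀ * c * ε := by
    rcases abs_choice (x k₀) with h | h
    · exact ⟨1, Or.inl rfl, by rw [mul_one, ← hx k₀ hk₀, h]⟩
    · exact ⟨-1, Or.inr rfl, by rw [← hx k₀ hk₀, h]; ring⟩
  have e1 : x k₀ + 2 ^ (e k₀ + 1) * c * q = 2 ^ e k₀ * c * (ε + 2 * q) := by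
    rw [hxε]; ring
  have h3 : 1 ≤ |ε + 2 * q| := by
    apply Int.one_le_abs
    omega
  rw [e1, abs_mul, abs_mul, abs_of_pos hc, abs_of_pos (by positivity)]
  nlinarith [mul_le_mul_of_nonneg_right h2 hc.le, mul_pos (show (0 : ℤ) < 2 ^ e k₀ by positivity) hc]

/-- Distinct exponents in `1, …, M` contribute at most `2 + 4 + … + 2 ^ M`. -/
theorem sum_abs_le_of_injOn {κ : Type*} (R : Finset κ) (e : κ → ℕ) (he : Set.InjOn e R) {M : ℕ}
    (hpos : ∀ k ∈ R, e k ∈ Set.Icc 1 M) (x : κ → ℤ) {c : ℤ} (hc : 0 ≤ c)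
    (hx : ∀ k ∈ R, |x k| = 2 ^ e k * c) : |∑ k ∈ R, x k| ≤ (2 ^ (M + 1) - 2) * c := by
  classical
  have hgeom : ∀ M : ℕ, ∑ j ∈ Finset.Icc 1 M, (2 : ℤ) ^ j = 2 ^ (M + 1) - 2 := by
    intro M
    induction M with
    | zero => simp
    | succ M ih => rw [Finset.sum_Icc_succ_top (by omega), ih]; ring
  calc |∑ k ∈ R, x k| ≤ ∑ k ∈ R, |x k| := Finset.abs_sum_le_sum_abs _ _
    _ = (∑ j ∈ R.image e, (2 : ℤ) ^ j) * c := by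
      rw [Finset.sum_image he, Finset.sum_mul]
      exact Finset.sum_congr rfl hx
    _ ≤ (∑ j ∈ Finset.Icc 1 M, (2 : ℤ) ^ j) * c := by
      refine mul_le_mul_of_nonneg_right ?_ hc
      refine Finset.sum_le_sum_of_subset_of_nonneg ?_ fun _ _ _ => by positivity
      intro j hj
      obtain ⟨k, hk, rfl⟩ := Finset.mem_image.1 hj
      exact Finset.mem_Icc.2 (hpos k hk)
    _ = _ := by rw [hgeom]

namespace ComponentTree

open WorkingTree

variable {V ι : Type*} {G : SimpleGraph V} {D : ComponentTree G ι} {N : ι}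
  {br : ι → Finset V} {center : Set ι → ι} {A B B' : Set ι}
  {n : ℕ} [NeZero n] {d : ZMod n → G.Dart}

/-! ### The part of a cycle in a subtree -/

open scoped Classical in
/-- The weight of those edges of the cycle `d` that are drawn in a component in `X`. -/
noncomputable def part (D : ComponentTree G ι) (d : ZMod n → G.Dart) (w : EdgeWeight G)
    (X : Set ι) : ℤ :=
  ∑ k with D.home (d k).edge ∈ X, w (d k)

theorem part_eq_zero {w : EdgeWeight G} {X : Set ι} (h : ∀ k, D.home (d k).edge ∉ X) :
    D.part d w X = 0 := by
  classical
  rw [part, Finset.filter_false_of_mem fun k _ => h k, Finset.sum_empty]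

theorem part_eq_sum {w : EdgeWeight G} {X : Set ι} (h : ∀ k, D.home (d k).edge ∈ X) :
    D.part d w X = ∑ k, w (d k) := by
  classical
  rw [part, Finset.filter_true_of_mem fun k _ => h k]

theorem part_eq_add_sum [Finite ι] (S : SimpleGraph ι) (w : EdgeWeight G) (hc : center A ∈ A) :
    D.part d w A = D.part d w {center A} + ∑ B ∈ children S center A, D.part d w B := by
  classical
  simp only [part, Finset.sum_filter]
  rw [Finset.sum_comm, ← Finset.sum_add_distrib]
  refine Finset.sum_congr rfl fun k _ => ?_
  set j := D.home (d k).edge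
  by_cases hj : j = center A
  · have h0 : ∀ B ∈ children S center A, (if j ∈ B then w (d k) else 0) = 0 := by
      intro B hB
      rw [if_neg]
      rw [hj]
      exact (mem_children.1 hB).center_notMem
    rw [Finset.sum_eq_zero h0]
    simp [hj, hc]
  · by_cases hA : j ∈ A
    · obtain ⟨B, hB, hjB⟩ := exists_child (S := S) hA hj
      rw [Finset.sum_eq_single B]
      · simp [hA, hj, hjB]
      · intro B' hB' hne
        rw [if_neg]
        exact fun h => hne ((mem_children.1 hB').eq_of_mem hB h hjB)
      · exact fun h => (h (mem_children.2 hB)).elim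
    · have h0 : ∀ B ∈ children S center A, (if j ∈ B then w (d k) else 0) = 0 := by
        intro B hB
        rw [if_neg]
        exact fun h => hA ((mem_children.1 hB).subset h)
      rw [Finset.sum_eq_zero h0]
      simp [hA, hj]

/-- The weights `w₀` of the edges drawn in a component that is not planar. -/
def IsNumbered (D : ComponentTree G ι) (N : ι) (c : ℤ) (w : EdgeWeight G) : Prop :=
  ∃ num : Sym2 V → ℕ, Set.BijOn num (D.realEdges N) (Set.Icc 1 (D.realEdges N).ncard) ∧
    ∀ d : G.Dart, d.edge ∈ D.realEdges N → |w d| = 2 ^ num d.edge * c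

theorem mem_realEdges {e : G.Dart} : e.edge ∈ D.realEdges N ↔ D.home e.edge = N := by
  simp [realEdges]

open scoped Classical in
theorem IsNumbered.spec {c : ℤ} {w : EdgeWeight G} (h : D.IsNumbered N c w)
    (hd : IsDartCycle d) : ∃ e : ZMod n → ℕ,
      Set.InjOn e (Finset.univ.filter fun k => D.home (d k).edge ∈ ({N} : Set ι)) ∧
      ∀ k ∈ Finset.univ.filter fun k => D.home (d k).edge ∈ ({N} : Set ι),
        e k ∈ Set.Icc 1 (D.realEdges N).ncard ∧ |w (d k)| = 2 ^ e k * c := by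
  obtain ⟨num, hnum, hw⟩ := h
  have hmem : ∀ k ∈ Finset.univ.filter fun k => D.home (d k).edge ∈ ({N} : Set ι),
      (d k).edge ∈ D.realEdges N := fun k hk => mem_realEdges.2 (by simpa using hk)
  exact ⟨fun k => num (d k).edge,
    fun k hk j hj h => hd.edge_injective (hnum.injOn (hmem k hk) (hmem j hj) h),
    fun k hk => ⟨hnum.mapsTo (hmem k hk), hw _ (hmem k hk)⟩⟩

theorem IsNumbered.abs_part_le {c : ℤ} {w : EdgeWeight G} (h : D.IsNumbered N c w)
    (hd : IsDartCycle d) (hc : 0 ≤ c) {m : ℕ} (hm : (D.realEdges N).ncard ≤ m) :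
    |D.part d w {N}| ≤ (2 ^ (m + 1) - 2) * c := by
  classical
  obtain ⟨e, he, hspec⟩ := h.spec hd
  exact sum_abs_le_of_injOn _ e he (fun k hk => ⟨(hspec k hk).1.1, (hspec k hk).1.2.trans hm⟩) _ hc
    fun k hk => (hspec k hk).2

theorem IsNumbered.two_mul_le_abs_part {c : ℤ} {w : EdgeWeight G} (h : D.IsNumbered N c w)
    (hd : IsDartCycle d) (hc : 0 < c) {k : ZMod n} (hk : D.home (d k).edge = N) :
    2 * c ≤ |D.part d w {N}| := by
  classical
  obtain ⟨e, he, hspec⟩ := h.spec hd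
  exact two_mul_le_abs_sum _ ⟨k, by simpa using hk⟩ e he (fun k hk => (hspec k hk).1.1) _ hc
    fun k hk => (hspec k hk).2

variable [Finite V]

open scoped Classical in
/-- The weight of the edges of a cycle that are drawn in a planar component, in terms of the number
of adjacent faces inside. -/
theorem abs_part_planar [Finite ι] (hG : G.Connected)
    (hone : ∀ i σ τ v, D.sep i σ → D.sep i τ → v ∈ σ → v ∈ τ → σ = τ)
    (hcenter : ∀ A : Set ι, A.Nonempty → center A ∈ A) (hA : Piece D.tree center A)
    (E : D.PlaneEmbedding (center A))
    (htri : ∀ τ, D.sep (center A) τ → τ.card = 3 →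
      ∃ f, E.IsInnerFace f ∧ IsVirtualTriangle τ f)
    (hd : IsDartCycle d) {k₀ : ZMod n} (hk₀ : D.home (d k₀).edge = center A) {K : ℕ}
    {w : EdgeWeight G} (hw : w.SkewSymmetric)
    (hwf : ∀ f, E.IsInnerFace f → D.NonVirtual (center A) f →
      faceCirculation w f = D.prescribed K center A f) :
    ∃ t : Set ι → ℕ, |D.part d w {center A}| =
        ∑ B ∈ children D.tree center A, 2 * scale D.tree center K B * t B ∧
      ∀ B ∈ children D.tree center A,
        t B ≤ 3 ∧ ∀ k, D.home (d k).edge ∈ B → 1 ≤ t B := by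
  obtain ⟨br, hbr⟩ := exists_branching hone (center A)
  obtain ⟨I, s, hs, hI, hsum, -, htouch⟩ := exists_faces_inside hG hone hbr E hd hk₀
  let I' := (Set.toFinite I).toFinset
  -- Double counting of pairs of a face inside and a subtree adjacent to it: `t B` is the number of
  -- faces charged for `B`.
  let t : Set ι → ℕ := fun B =>
    (I'.filter fun f => D.NonVirtual (center A) f ∧ D.AdjacentToAttachment center A B f).card
  have hcirc : ∀ f ∈ I', faceCirculation w f = ∑ B ∈ children D.tree center A,
      if D.NonVirtual (center A) f ∧ D.AdjacentToAttachment center A B f then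
        2 * scale D.tree center K B else 0 := by
    intro f hf
    have hf' : E.IsInnerFace f := hI f (by simpa [I'] using hf)
    by_cases hnv : D.NonVirtual (center A) f
    · rw [hwf f hf' hnv, prescribed, finsum_mem_eq_finite_toFinset_sum _ (Set.toFinite _),
        ← Finset.sum_filter]
      refine Finset.sum_congr ?_ fun B _ => ?_
      · ext B; simp [hnv]
      · rw [scale, mul_assoc]
    · obtain ⟨τ, -, h⟩ := not_not.1 hnv
      rw [h.faceCirculation_eq_zero, Finset.sum_eq_zero]
      intro B _
      rw [if_neg fun h => hnv h.1]
  have htotal : ∑ᶠ f ∈ I, faceCirculation w f =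
      ∑ B ∈ children D.tree center A, 2 * scale D.tree center K B * t B := by
    rw [finsum_mem_eq_finite_toFinset_sum _ (Set.toFinite I), Finset.sum_congr rfl hcirc,
      Finset.sum_comm]
    refine Finset.sum_congr rfl fun B _ => ?_
    rw [← Finset.sum_filter, Finset.sum_const, nsmul_eq_mul, mul_comm]
  refine ⟨t, ?_, fun B hB => ?_⟩
  · have h1 : D.part d w {center A} = s * ∑ᶠ f ∈ I, faceCirculation w f := by
      rw [← hsum w hw]
      rfl
    rw [h1, htotal, abs_mul, show |s| = 1 by rcases hs with rfl | rfl <;> simp, one_mul,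
      abs_of_nonneg]
    exact Finset.sum_nonneg fun B _ =>
      mul_nonneg (mul_nonneg (by norm_num) (scale_nonneg K B)) (by positivity)
  · rw [mem_children] at hB
    obtain ⟨x, hx⟩ := hB.nonempty
    constructor
    · refine card_faces_le_three E htri (hbr.sep_br x trivial (hB.subset_diff hx).2) _
        fun f hf => ?_
      obtain ⟨hf, hnv, hadj⟩ := Finset.mem_filter.1 hf
      exact ⟨(hI f (by simpa [I'] using hf)).1, hnv,
        (adjacentToAttachment_iff hone hcenter hbr hA hB hx f).1 hadj⟩
    · intro k hk
      obtain ⟨f, hf, hnv, h⟩ := htouch k (hB.subset_diff hk).2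
      refine Finset.card_pos.2 ⟨f, Finset.mem_filter.2 ⟨by simpa [I'] using hf, hnv, ?_⟩⟩
      exact (adjacentToAttachment_iff hone hcenter hbr hA hB hk f).2 h

open scoped Classical in
/-- The weight `w₁` of a cycle within a planar component is not zero. -/
theorem part_ne_zero_of_planar (hG : G.Connected)
    (hone : ∀ i σ τ v, D.sep i σ → D.sep i τ → v ∈ σ → v ∈ τ → σ = τ)
    (E : D.PlaneEmbedding N) (hd : IsDartCycle d) {k₀ : ZMod n}
    (hk₀ : D.home (d k₀).edge = N) {w : EdgeWeight G} (hw : w.SkewSymmetric)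
    (hwf : ∀ f, E.IsInnerFace f → D.NonVirtual N f → faceCirculation w f = 1) :
    D.part d w {N} ≠ 0 := by
  obtain ⟨br, hbr⟩ := exists_branching hone N
  obtain ⟨I, s, hs, hI, hsum, ⟨f₀, hf₀, hnv₀⟩, -⟩ := exists_faces_inside hG hone hbr E hd hk₀
  have h1 : D.part d w {N} = s * ∑ᶠ f ∈ I, faceCirculation w f := by
    rw [← hsum w hw]
    rfl
  have h2 : 0 < ∑ᶠ f ∈ I, faceCirculation w f := by
    rw [finsum_mem_eq_finite_toFinset_sum _ (Set.toFinite I)]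
    refine Finset.sum_pos' (fun f hf => ?_)
      ⟨f₀, by simpa using hf₀, by rw [hwf f₀ (hI f₀ hf₀) hnv₀]; norm_num⟩
    have hf' : E.IsInnerFace f := hI f (by simpa using hf)
    by_cases hnv : D.NonVirtual N f
    · rw [hwf f hf' hnv]; norm_num
    · obtain ⟨τ, -, h⟩ := not_not.1 hnv
      rw [h.faceCirculation_eq_zero]
  rw [h1]
  refine mul_ne_zero ?_ h2.ne'
  rcases hs with rfl | rfl <;> norm_num

end ComponentTree

namespace ComponentTree

open WorkingTree

variable {V ι : Type*} {G : SimpleGraph V} {D : ComponentTree G ι} {center : Set ι → ι}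
  {A : Set ι} {n : ℕ} [NeZero n] {d : ZMod n → G.Dart} {P : Set ι}
  {emb : ∀ i ∈ P, D.PlaneEmbedding i} {m K : ℕ} {w : EdgeWeight G}

/-! ### The weight of the part of a cycle in a subtree -/

/-- The unit `K ^ (h - 1) * l` measures everything at a node: the attached subtrees have at most one
unit together, the subtree itself is allowed `K` units. -/
theorem sum_children_le [Finite ι] (hcenter : ∀ A : Set ι, A.Nonempty → center A ∈ A)
    (hK : max (2 ^ (m + 2)) 7 < K) (hA : Piece D.tree center A) (hne : A.Nonempty) :
    ∑ B ∈ children D.tree center A, scale D.tree center K B ≤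
        (K : ℤ) ^ (height D.tree center A - 1) * (leaves D.tree center A : ℤ) ∧
      0 < (K : ℤ) ^ (height D.tree center A - 1) * (leaves D.tree center A : ℤ) ∧
      scale D.tree center K A =
        K * ((K : ℤ) ^ (height D.tree center A - 1) * (leaves D.tree center A : ℤ)) := by
  have hK0 : 0 < K := by omega
  refine ⟨sum_scale_le hcenter hK0 hA hne, ?_, ?_⟩
  · have h1 : 0 < leaves D.tree center A := one_le_leaves hcenter hne
    positivity
  · rw [scale, ← mul_assoc, ← pow_succ', Nat.sub_add_cancel (one_le_height hA)]

/-- Measured in that unit, the parts below the root add at most one by induction. A planar root adds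
at most `6 = 2 * 3`, up to three faces per subtree; any other root adds at most `2 ^ (m + 1) - 2`.
Both totals are below `K`. -/
theorem abs_part_lt_scale [Finite V] [Finite ι] (hG : G.Connected)
    (hone : ∀ i σ τ v, D.sep i σ → D.sep i τ → v ∈ σ → v ∈ τ → σ = τ)
    (htri : ∀ i (hi : i ∈ P) τ, D.sep i τ → τ.card = 3 →
      ∃ f, (emb i hi).IsInnerFace f ∧ IsVirtualTriangle τ f)
    (hm : ∀ i ∉ P, (D.realEdges i).ncard ≤ m) (hK : max (2 ^ (m + 2)) 7 < K)
    (hcenter : ∀ A : Set ι, A.Nonempty → center A ∈ A) (hw : D.IsW₀ P emb K center w)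
    (hd : IsDartCycle d) (hne : A.Nonempty) (hA : Piece D.tree center A) :
    |D.part d w A| < scale D.tree center K A := by
  revert hA
  refine piece_induction (S := D.tree) (center := center)
    (p := fun A => Piece D.tree center A → |D.part d w A| < scale D.tree center K A)
    hcenter ?_ A hne
  intro A hne ih hA
  obtain ⟨h1, h2, h3⟩ := sum_children_le hcenter hK hA hne
  obtain ⟨hplanar, hsmall⟩ := hw.2 A hA
  set X : ℤ := (K : ℤ) ^ (height D.tree center A - 1) * (leaves D.tree center A : ℤ)
  have h4 : |∑ B ∈ children D.tree center A, D.part d w B| ≤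
      ∑ B ∈ children D.tree center A, scale D.tree center K B :=
    (Finset.abs_sum_le_sum_abs _ _).trans (Finset.sum_le_sum fun B hB =>
      (ih B (mem_children.1 hB) (hA.child (mem_children.1 hB))).le)
  have h5 := abs_add_le (D.part d w {center A}) (∑ B ∈ children D.tree center A, D.part d w B)
  rw [part_eq_add_sum D.tree w (hcenter A hne), h3]
  by_cases hP : center A ∈ P
  · have h6 : |D.part d w {center A}| ≤ 6 * X := by
      by_cases hk : ∃ k, D.home (d k).edge = center A
      · obtain ⟨k, hk⟩ := hk
        obtain ⟨t, ht, ht'⟩ := abs_part_planar hG hone hcenter hA (emb _ hP) (htri _ hP) hd hk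
          (K := K) hw.1 (hplanar hP)
        rw [ht]
        calc ∑ B ∈ children D.tree center A, 2 * scale D.tree center K B * t B
            ≤ ∑ B ∈ children D.tree center A, 6 * scale D.tree center K B := by
              refine Finset.sum_le_sum fun B hB => ?_
              have h7 : (t B : ℤ) ≤ 3 := by exact_mod_cast (ht' B hB).1
              have := scale_nonneg (S := D.tree) (center := center) K B
              nlinarith
          _ = 6 * ∑ B ∈ children D.tree center A, scale D.tree center K B := by
              rw [Finset.mul_sum]
          _ ≤ 6 * X := by linarith
      · push Not at hk
        rw [part_eq_zero hk, abs_zero]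
        positivity
    have h7 : (7 : ℤ) < K := by exact_mod_cast (lt_of_le_of_lt (le_max_right _ _) hK)
    nlinarith
  · have h6 : |D.part d w {center A}| ≤ (2 ^ (m + 1) - 2) * X := by
      have hnum : D.IsNumbered (center A) X w := by
        obtain ⟨num, h, h'⟩ := hsmall hP
        exact ⟨num, h, fun e he => by rw [h' e he, mul_assoc]⟩
      exact hnum.abs_part_le hd h2.le (hm _ hP)
    have h7 : ((2 ^ (m + 2) : ℕ) : ℤ) < K := by
      exact_mod_cast (lt_of_le_of_lt (le_max_left _ _) hK)
    push_cast at h7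
    have h8 : (2 : ℤ) ^ (m + 2) = 2 * 2 ^ (m + 1) := by ring
    have h9 : (0 : ℤ) < 2 ^ (m + 1) := by positivity
    nlinarith

/-- Every cycle lies in a subtree of the working tree whose root it uses. -/
theorem exists_piece_of_cycle [Finite ι]
    (hone : ∀ i σ τ v, D.sep i σ → D.sep i τ → v ∈ σ → v ∈ τ → σ = τ)
    (htwo : ∀ τ, {i | D.sep i τ}.ncard ≤ 2)
    (hcenter : ∀ A : Set ι, A.Nonempty → center A ∈ A) (hd : IsDartCycle d) :
    ∃ A, Piece D.tree center A ∧ A.Nonempty ∧ (∀ k, D.home (d k).edge ∈ A) ∧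
      ∃ k, D.home (d k).edge = center A := by
  refine piece_induction (S := D.tree) (center := center)
    (p := fun A => Piece D.tree center A → (∀ k, D.home (d k).edge ∈ A) →
      ∃ A, Piece D.tree center A ∧ A.Nonempty ∧ (∀ k, D.home (d k).edge ∈ A) ∧
        ∃ k, D.home (d k).edge = center A)
    hcenter ?_ Set.univ ⟨D.home (d 0).edge, trivial⟩ .refl (fun _ => trivial)
  intro A hne ih hA hk
  by_cases hc : ∃ k, D.home (d k).edge = center A
  · exact ⟨A, hA, hne, hk, hc⟩
  push Not at hc
  obtain ⟨br, hbr⟩ := exists_branching hone (center A)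
  obtain ⟨B, hB, hB0⟩ := exists_child (S := D.tree) (hk 0) (hc 0)
  -- Consecutive edges share a vertex and avoid the center, so they lie behind the same separating
  -- set, which leads to one child only.
  have hall : ∀ k : ℕ, D.home (d k).edge ∈ B := by
    intro k
    induction k with
    | zero => simpa using hB0
    | succ k ihk =>
      obtain ⟨B', hB', hk'⟩ := exists_child (S := D.tree) (hk (k + 1 : ℕ)) (hc _)
      have e : br (D.home (d k).edge) = br (D.home (d (k + 1 : ℕ)).edge) := by
        refine hbr.congr _ trivial (hc _) _ trivial (hc _) (d k).snd (home_mem_bag _).2 ?_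
        rw [← hd.next, Nat.cast_succ]
        exact (home_mem_bag _).1
      rwa [child_eq_of_branch_eq hone htwo hcenter hbr hA hB hB' ihk hk' e]
  refine ih B hB (hA.child hB) fun k => ?_
  have := hall k.val
  rwa [ZMod.natCast_zmod_val] at this

/-- A subtree entered by the cycle adds at least twice its scale to a planar root but has less than
its scale below; a nonplanar root has at least two units against one. When the cycle stays in a
planar root, faces without attachments have `w₀`-circulation zero, and `w₁` is needed. -/
theorem sum_ne_zero_or_sum_ne_zero [Finite V] [Finite ι] (hG : G.Connected)
    (hone : ∀ i σ τ v, D.sep i σ → D.sep i τ → v ∈ σ → v ∈ τ → σ = τ)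
    (htwo : ∀ τ, {i | D.sep i τ}.ncard ≤ 2)
    (htri : ∀ i (hi : i ∈ P) τ, D.sep i τ → τ.card = 3 →
      ∃ f, (emb i hi).IsInnerFace f ∧ IsVirtualTriangle τ f)
    (hm : ∀ i ∉ P, (D.realEdges i).ncard ≤ m) (hK : max (2 ^ (m + 2)) 7 < K)
    (hcenter : ∀ A : Set ι, A.Nonempty → center A ∈ A) {w₀ w₁ : EdgeWeight G}
    (hw₀ : D.IsW₀ P emb K center w₀) (hw₁ : D.IsW₁ P emb w₁) (hd : IsDartCycle d) :
    ∑ k, w₀ (d k) ≠ 0 ∨ ∑ k, w₁ (d k) ≠ 0 := by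
  classical
  obtain ⟨A, hA, hne, hall, k₀, hk₀⟩ := exists_piece_of_cycle hone htwo hcenter hd
  obtain ⟨h1, h2, -⟩ := sum_children_le hcenter hK hA hne
  obtain ⟨hplanar, hsmall⟩ := hw₀.2 A hA
  have hlt : ∀ B ∈ children D.tree center A, |D.part d w₀ B| < scale D.tree center K B :=
    fun B hB => abs_part_lt_scale hG hone htri hm hK hcenter hw₀ hd (mem_children.1 hB).nonempty
      (hA.child (mem_children.1 hB))
  have hsum := part_eq_add_sum (D := D) (d := d) D.tree w₀ (hcenter A hne)
  rw [part_eq_sum hall] at hsum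
  -- the part in the root is larger than the part below the root
  have hfinish : |∑ B ∈ children D.tree center A, D.part d w₀ B| < |D.part d w₀ {center A}| →
      ∑ k, w₀ (d k) ≠ 0 := by
    intro h h0
    rw [hsum] at h0
    rw [eq_neg_of_add_eq_zero_left h0, abs_neg] at h
    exact h.false
  by_cases hP : center A ∈ P
  · by_cases hout : ∀ k, D.home (d k).edge = center A
    · right
      have := part_ne_zero_of_planar hG hone (emb _ hP) hd hk₀ hw₁.1 (hw₁.2.1 _ hP)
      rwa [part_eq_sum (by simpa using hout)] at this
    · left
      push Not at hout
      obtain ⟨k₁, hk₁⟩ := hout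
      obtain ⟨t, ht, ht'⟩ := abs_part_planar hG hone hcenter hA (emb _ hP) (htri _ hP) hd hk₀
        (K := K) hw₀.1 (hplanar hP)
      apply hfinish
      rw [ht]
      refine (Finset.abs_sum_le_sum_abs _ _).trans_lt ?_
      have hpos : ∀ B ∈ children D.tree center A, 0 < scale D.tree center K B :=
        fun B hB => (abs_nonneg _).trans_lt (hlt B hB)
      have htouched : ∀ B ∈ children D.tree center A, ∀ k, D.home (d k).edge ∈ B →
          |D.part d w₀ B| < 2 * scale D.tree center K B * t B := by
        intro B hB k hk
        have h3 : (1 : ℤ) ≤ t B := by exact_mod_cast (ht' B hB).2 k hk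
        have := hlt B hB
        have := hpos B hB
        nlinarith
      obtain ⟨B₁, hB₁, hkB⟩ := exists_child (S := D.tree) (hall k₁) hk₁
      refine Finset.sum_lt_sum (fun B hB => ?_)
        ⟨B₁, mem_children.2 hB₁, htouched B₁ (mem_children.2 hB₁) k₁ hkB⟩
      by_cases h : ∃ k, D.home (d k).edge ∈ B
      · obtain ⟨k, hk⟩ := h
        exact (htouched B hB k hk).le
      · push Not at h
        rw [part_eq_zero h, abs_zero]
        have := hpos B hB
        positivity
  · left
    have hnum : D.IsNumbered (center A)
        ((K : ℤ) ^ (height D.tree center A - 1) * (leaves D.tree center A : ℤ)) w₀ := by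
      obtain ⟨num, h, h'⟩ := hsmall hP
      exact ⟨num, h, fun e he => by rw [h' e he, mul_assoc]⟩
    have h3 := hnum.two_mul_le_abs_part hd h2 hk₀
    apply hfinish
    have h4 : |∑ B ∈ children D.tree center A, D.part d w₀ B| ≤
        ∑ B ∈ children D.tree center A, scale D.tree center K B :=
      (Finset.abs_sum_le_sum_abs _ _).trans (Finset.sum_le_sum fun B hB => (hlt B hB).le)
    linarith

/-! ### Existence of the weights -/

/-- Weights of the components may be chosen independently. -/
theorem exists_weight_of_component [Finite V]
    (hG : G.Connected)
    (hone : ∀ i σ τ v, D.sep i σ → D.sep i τ → v ∈ σ → v ∈ τ → σ = τ)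
    (htri : ∀ i (hi : i ∈ P) τ, D.sep i τ → τ.card = 3 →
      ∃ f, (emb i hi).IsInnerFace f ∧ IsVirtualTriangle τ f)
    (t : ι → Set (Arc G) → ℤ) (u : ι → EdgeWeight G) (hu : ∀ i, (u i).SkewSymmetric) :
    ∃ w : EdgeWeight G, w.SkewSymmetric ∧
      (∀ i (hi : i ∈ P) f, (emb i hi).IsInnerFace f → D.NonVirtual i f →
        faceCirculation w f = t i f) ∧
      ∀ i ∉ P, ∀ e : G.Dart, e.edge ∈ D.realEdges i → w e = u i e := by
  classical
  have hex : ∀ i (hi : i ∈ P), ∃ v : EdgeWeight G, v.SkewSymmetric ∧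
      ∀ f, (emb i hi).IsInnerFace f → D.NonVirtual i f → faceCirculation v f = t i f :=
    fun i hi => (emb i hi).exists_weight
      (fun _ hu _ hv => link_connected hG hone hu hv) hone (htri i hi) (t i)
  choose v hv hvf using hex
  refine ⟨fun e => if h : D.home e.edge ∈ P then v _ h e else u (D.home e.edge) e,
    fun e => ?_, fun i hi f hf hnv => ?_, fun i hi e he => ?_⟩
  · simp only [SimpleGraph.Dart.edge_symm]
    split_ifs with h
    · exact hv _ h e
    · exact hu _ e
  · rw [← hvf i hi f hf hnv]
    refine finsum_mem_congr rfl fun a ha => ?_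
    rcases a with e | p
    · have h := inl_mem_arcs.1 ((emb i hi).eq_face_of_mem hf.1 ha).1
      subst h
      simp [hi]
    · rfl
  · have h := mem_realEdges.1 he
    subst h
    simp [hi]

theorem exists_isW₁ [Finite V] (hG : G.Connected)
    (hone : ∀ i σ τ v, D.sep i σ → D.sep i τ → v ∈ σ → v ∈ τ → σ = τ)
    (htri : ∀ i (hi : i ∈ P) τ, D.sep i τ → τ.card = 3 →
      ∃ f, (emb i hi).IsInnerFace f ∧ IsVirtualTriangle τ f) :
    ∃ w₁ : EdgeWeight G, D.IsW₁ P emb w₁ := by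
  obtain ⟨w, hw, h1, h2⟩ := exists_weight_of_component (emb := emb) hG hone htri (fun _ _ => 1)
    (fun _ => 0) (fun _ d => by simp)
  exact ⟨w, hw, h1, h2⟩

/-- A component is the center of at most one piece, so the requirements of different pieces concern
different components and can be met independently. -/
theorem exists_isW₀ [Finite V] [Finite ι] (hG : G.Connected)
    (hone : ∀ i σ τ v, D.sep i σ → D.sep i τ → v ∈ σ → v ∈ τ → σ = τ)
    (htri : ∀ i (hi : i ∈ P) τ, D.sep i τ → τ.card = 3 →
      ∃ f, (emb i hi).IsInnerFace f ∧ IsVirtualTriangle τ f)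
    (hcenter : ∀ A : Set ι, A.Nonempty → center A ∈ A) (K : ℕ) :
    ∃ w₀ : EdgeWeight G, D.IsW₀ P emb K center w₀ := by
  classical
  -- the piece with a given center
  let piece : ι → Set ι := fun i =>
    if h : ∃ A, Piece D.tree center A ∧ center A = i then h.choose else ∅
  have hne : (Set.univ : Set ι).Nonempty := by
    obtain ⟨v⟩ := hG.nonempty
    obtain ⟨i, -⟩ := D.cover v
    exact ⟨i, trivial⟩
  have hpiece : ∀ A, Piece D.tree center A → piece (center A) = A := by
    intro A hA
    have h : ∃ A', Piece D.tree center A' ∧ center A' = center A := ⟨A, hA, rfl⟩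
    simp only [piece, dif_pos h]
    exact Below.eq_of_center_eq hcenter hne h.choose_spec.1 hA h.choose_spec.2
  have hnum : ∀ i, ∃ num : Sym2 V → ℕ,
      Set.BijOn num (D.realEdges i) (Set.Icc 1 (D.realEdges i).ncard) := by
    intro i
    have hcard : (D.realEdges i).encard = (Set.Icc 1 (D.realEdges i).ncard).encard := by
      rw [← (Set.toFinite (D.realEdges i)).cast_ncard_eq,
        ← (Set.toFinite (Set.Icc 1 (D.realEdges i).ncard)).cast_ncard_eq]
      simp [Set.ncard_eq_toFinset_card']
    exact (Set.toFinite (D.realEdges i)).exists_bijOn_of_encard_eq hcard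
  choose num hbij using hnum
  let _ : LinearOrder V := linearOrderOfSTO WellOrderingRel
  let σ : G.Dart → ℤ := fun e => if e.fst < e.snd then 1 else -1
  have hσ : ∀ e : G.Dart, σ e.symm = -σ e := by
    intro e
    have h : e.symm.fst = e.snd ∧ e.symm.snd = e.fst := ⟨rfl, rfl⟩
    simp only [σ, h.1, h.2]
    rcases lt_or_gt_of_ne e.fst_ne_snd with h | h <;> simp [h, h.not_gt]
  have hσ' : ∀ e, |σ e| = 1 := by intro e; simp only [σ]; split_ifs <;> simp
  obtain ⟨w, hw, h1, h2⟩ := exists_weight_of_component (emb := emb) hG hone htri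
    (fun i f => D.prescribed K center (piece i) f)
    (fun i e => σ e * (2 ^ num i e.edge *
      (K : ℤ) ^ (height D.tree center (piece i) - 1) * (leaves D.tree center (piece i) : ℤ)))
    (fun i e => by simp only [hσ, SimpleGraph.Dart.edge_symm]; ring)
  refine ⟨w, hw, fun A hA => ⟨fun hP f hf hnv => ?_, fun hP => ⟨num (center A), hbij _, ?_⟩⟩⟩
  · rw [h1 _ hP f hf hnv, hpiece A hA]
  · intro e he
    rw [h2 _ hP e he, abs_mul, hσ', one_mul, hpiece A hA]
    exact abs_of_nonneg (by positivity)

end ComponentTree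

/-! ### Combining the two weights -/

/-- The directed edges of a cycle and their reverses are all distinct, and `total` counts both
directions. -/
theorem EdgeWeight.two_mul_abs_sum_le_total {V : Type*} {G : SimpleGraph V} [Finite V] {n : ℕ}
    [NeZero n] {d : ZMod n → G.Dart} (hd : IsDartCycle d) {w : EdgeWeight G}
    (hw : w.SkewSymmetric) : 2 * |∑ k, w (d k)| ≤ w.total := by
  classical
  let _ : Fintype G.Dart := Fintype.ofFinite _
  rw [EdgeWeight.total, finsum_eq_sum_of_fintype]
  let f : ZMod n ⊕ ZMod n → G.Dart := Sum.elim d fun k => (d k).symm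
  have hf : Function.Injective f := by
    rintro (k | k) (j | j) h
    · rw [hd.injective h]
    · exact (hd.ne_symm k j h).elim
    · exact (hd.ne_symm j k h.symm).elim
    · rw [hd.injective (SimpleGraph.Dart.symm_involutive.injective h)]
  calc 2 * |∑ k, w (d k)| ≤ 2 * ∑ k, |w (d k)| := by
        gcongr; exact Finset.abs_sum_le_sum_abs _ _
    _ = ∑ x, |w (f x)| := by
        rw [Fintype.sum_sum_type]
        simp only [f, Sum.elim_inl, Sum.elim_inr, hw _, abs_neg]
        ring
    _ = ∑ e ∈ Finset.univ.image f, |w e| := by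
        rw [Finset.sum_image hf.injOn]
    _ ≤ ∑ e, |w e| :=
        Finset.sum_le_sum_of_subset_of_nonneg (Finset.subset_univ _) fun _ _ _ => abs_nonneg _

/-- Two numbers, the first of which is scaled so that the other one is too small to cancel it. -/
theorem add_ne_zero_of_scaled {α β x y T : ℤ} (hβ : β ≠ 0) (h : |β| * T < 2 * |α|)
    (hy : 2 * |y| ≤ T) (hxy : x ≠ 0 ∨ y ≠ 0) : α * x + β * y ≠ 0 := by
  by_cases hx : x = 0
  · subst hx
    simpa [hβ] using hxy
  · intro h0
    have h1 : |α| * |x| = |β| * |y| := by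
      rw [← abs_mul, ← abs_mul, eq_neg_of_add_eq_zero_left h0, abs_neg]
    have h2 : 1 ≤ |x| := Int.one_le_abs hx
    have h3 : |β| * (2 * |y|) ≤ |β| * T := mul_le_mul_of_nonneg_left hy (abs_nonneg β)
    nlinarith [mul_le_mul_of_nonneg_left h2 (abs_nonneg α)]

theorem mainTheorem3 {V ι : Type*} [Finite V] [Finite ι]
    (G : SimpleGraph V) (hG : G.Connected) (D : ComponentTree G ι)
    -- in every component, a vertex is part of at most one separating set
    (hone : ∀ i σ τ v, D.sep i σ → D.sep i τ → v ∈ σ → v ∈ τ → σ = τ)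
    -- every separating set is shared by at most two components
    (htwo : ∀ τ, {i | D.sep i τ}.ncard ≤ 2)
    -- every component is planar with a given embedding, or has at most `c` vertices
    (c : ℕ) (P : Set ι) (emb : ∀ i ∈ P, D.PlaneEmbedding i)
    (hsmall : ∀ i ∉ P, (D.bag i).card ≤ c)
    -- every virtual triangle in a planar component is an (inner) face
    (htri : ∀ i (hi : i ∈ P) τ, D.sep i τ → τ.card = 3 →
      ∃ f, (emb i hi).IsInnerFace f ∧ ComponentTree.IsVirtualTriangle τ f)
    (m K : ℕ) (hm : ∀ i ∉ P, (D.realEdges i).ncard ≤ m) (hK : max (2 ^ (m + 2)) 7 < K)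
    (center : Set ι → ι) (hcenter : ∀ A : Set ι, A.Nonempty → center A ∈ A) :
    (∃ w₀ w₁ : EdgeWeight G, D.IsW₀ P emb K center w₀ ∧ D.IsW₁ P emb w₁) ∧
    ∀ w₀ w₁ : EdgeWeight G, D.IsW₀ P emb K center w₀ → D.IsW₁ P emb w₁ →
      ∀ α β : ℤ, EdgeWeight.NonInterfering w₀ w₁ α β →
        EdgeWeight.SkewSymmetric (α • w₀ + β • w₁) ∧
        ∀ (v : V) (C : G.Walk v v), C.IsCycle →
          EdgeWeight.circulation (α • w₀ + β • w₁) C ≠ 0 := by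

  refine ⟨?_, fun w₀ w₁ hw₀ hw₁ α β hαβ => ⟨fun d => ?_, fun v C hC => ?_⟩⟩
  · obtain ⟨w₀, hw₀⟩ := ComponentTree.exists_isW₀ hG hone htri hcenter K
    obtain ⟨w₁, hw₁⟩ := ComponentTree.exists_isW₁ hG hone htri
    exact ⟨w₀, w₁, hw₀, hw₁⟩
  · simp only [Pi.add_apply, Pi.smul_apply, smul_eq_mul, hw₀.1 d, hw₁.1 d]
    ring
  · obtain ⟨n, _, d, hd, hcirc⟩ := hC.exists_isDartCycle
    have h := ComponentTree.sum_ne_zero_or_sum_ne_zero hG hone htwo htri hm hK hcenter hw₀ hw₁ hd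
    have e : ∑ k, (α • w₀ + β • w₁) (d k) = α * ∑ k, w₀ (d k) + β * ∑ k, w₁ (d k) := by
      simp only [Pi.add_apply, Pi.smul_apply, smul_eq_mul, Finset.sum_add_distrib, Finset.mul_sum]
    rw [hcirc, e]
    rcases hαβ with ⟨hβ, hlt⟩ | ⟨hα, hlt⟩
    · exact add_ne_zero_of_scaled hβ hlt (EdgeWeight.two_mul_abs_sum_le_total hd hw₁.1) h
    · rw [add_comm]
      exact add_ne_zero_of_scaled hα hlt (EdgeWeight.two_mul_abs_sum_le_total hd hw₀.1) h.symm
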